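/- Let $0<r<\frac{\pi}{2}$, let $\mathbb{S}^n\subset\mathbb{R}^{n+1}$ be the round unit sphere and let $\mathbb{B}^n(r)=\{x\in\mathbb{S}^n : x_0\ge\cos r\}$ be its geodesic ball with center $(1,0,\dots,0)$ and radius $r$, with boundary $\partial\mathbb{B}^n(r)=\{x\in\mathbb{S}^n : x_0=\cos r\}$. Let $(\Sigma^k,g)$ be a compact smooth Riemannian manifold with boundary of dimension $k\ge 1$, and let $\Phi:(\Sigma,g)\to\mathbb{B}^n(r)$ be a smooth isometric minimal immersion with free boundary; that is, the mean curvature vector of $\Phi$ in $\mathbb{S}^n$ vanishes, $\Phi(\partial\Sigma)\subset\partial\mathbb{B}^n(r)$, and $\Sigma$ meets $\partial\mathbb{B}^n(r)$ orthogonally. Then: 1. For every $\lambda\le 0$, the Dirichlet problem $$-\Delta_g w-kw=\lambda w\ \text{ in }\Sigma,\qquad w=0\ \text{ on }\partial\Sigma,$$ has no nontrivial (classical, $C^2$ up to the boundary) solution $w$. 2. Equivalently, the first Dirichlet eigenvalue satisfies $\lambda_0^D(g)>k$. Here $\lambda_0^D(g)$ is the infimum of the $\mu\in\mathbb{R}$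 for which $-\Delta_g w=\mu w$ in $\Sigma$, $w=0$ on $\partial\Sigma$ has a nontrivial solution. In variational form: there is a constant $c>k$, depending on $(\Sigma,g)$, with $\int_\Sigma|\nabla^g u|^2\,dA\ge c\int_\Sigma u^2\,dA$ for all $u\in C^\infty(\Sigma)$ with $u=0$ on $\partial\Sigma$. 3. In particular, for every $u\in C^\infty(\Sigma)$ with $u=0$ on $\partial\Sigma$, $$\int_\Sigma\big(|\nabla^g u|^2-ku^2\big)\,dA\ge 0 .$$ -/

import Mathlib

open MeasureTheory Set
open scoped Manifold ContDiff

noncomputable section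

namespace SphericalCap

/-- The ambient Euclidean space `ℝⁿ⁺¹`, with coordinates `x 0, …, x n`. -/
abbrev Ambient (n : ℕ) : Type := EuclideanSpace ℝ (Fin (n + 1))

/-- The geodesic ball `𝔹ⁿ(r)` of the unit sphere `𝕊ⁿ ⊆ ℝⁿ⁺¹` with center `(1, 0, …, 0)` and
radius `r`. -/
def cap (n : ℕ) (r : ℝ) : Set (Ambient n) :=
  {x | ‖x‖ = 1 ∧ Real.cos r ≤ x 0}

/-- The boundary `∂𝔹ⁿ(r)` of the geodesic ball. -/
def capBoundary (n : ℕ) (r : ℝ) : Set (Ambient n) :=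
  {x | ‖x‖ = 1 ∧ x 0 = Real.cos r}

variable {k : ℕ} [NeZero k]

/-- Smooth Riemannian metrics on a `k`-dimensional manifold with boundary `M`. -/
abbrev Metric (k : ℕ) [NeZero k] (M : Type*) [TopologicalSpace M]
    [ChartedSpace (EuclideanHalfSpace k) M] [IsManifold (𝓡∂ k) ∞ M] :=
  Bundle.ContMDiffRiemannianMetric (𝓡∂ k) ∞ (EuclideanSpace ℝ (Fin k))
    (fun p : M ↦ TangentSpace (𝓡∂ k) p)

variable {M : Type*} [TopologicalSpace M] [ChartedSpace (EuclideanHalfSpace k) M]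

/-- The coordinate partial derivative `∂ᵢ f` at `z`, for a function `f` on (an open subset of) the
half space. At boundary points of the half space it is the derivative within the half space. -/
def partialDeriv {F : Type*} [NormedAddCommGroup F] [NormedSpace ℝ F] (i : Fin k)
    (f : EuclideanSpace ℝ (Fin k) → F) (z : EuclideanSpace ℝ (Fin k)) : F :=
  fderivWithin ℝ f (range (𝓡∂ k)) z (EuclideanSpace.single i 1)

/-- The expression `f ∘ φ⁻¹` of a function `f` on `M` in the chart `φ` at `x₀`. -/
def inChart {F : Type*} (x₀ : M) (f : M → F) : EuclideanSpace ℝ (Fin k) → F :=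
  fun z ↦ f ((extChartAt (𝓡∂ k) x₀).symm z)

/-- The coordinate vector field `∂ᵢ` of the chart at `x₀`, at the point with coordinates `z`. -/
def coordVector (x₀ : M) (i : Fin k) (z : EuclideanSpace ℝ (Fin k)) :
    TangentSpace (𝓡∂ k) ((extChartAt (𝓡∂ k) x₀).symm z) :=
  mfderivWithin 𝓘(ℝ, EuclideanSpace ℝ (Fin k)) (𝓡∂ k) (extChartAt (𝓡∂ k) x₀).symm
    (range (𝓡∂ k)) z (EuclideanSpace.single i (1 : ℝ))

/-- The differential of `u : M → F` at `p`, as a linear map on the tangent space at `p`. -/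
def differential {F : Type*} [NormedAddCommGroup F] [NormedSpace ℝ F] (u : M → F) (p : M) :
    TangentSpace (𝓡∂ k) p →L[ℝ] F :=
  mfderiv (𝓡∂ k) 𝓘(ℝ, F) u p

/-- The tangent space `T_p ∂M` at a boundary point `p`: the vectors whose component in the
direction transversal to the boundary of the half space vanishes. -/
def boundaryTangent (p : M) : Set (TangentSpace (𝓡∂ k) p) :=
  {v | differential (extChartAt (𝓡∂ k) p) p v 0 = 0}

variable [IsManifold (𝓡∂ k) ∞ M]

/-- The matrix `g_{ij} = g(∂ᵢ, ∂ⱼ)` of the metric in the chart at `x₀`. -/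
def gramMatrix (g : Metric k M) (x₀ : M) (z : EuclideanSpace ℝ (Fin k)) :
    Matrix (Fin k) (Fin k) ℝ :=
  Matrix.of fun i j ↦
    g.inner ((extChartAt (𝓡∂ k) x₀).symm z) (coordVector x₀ i z) (coordVector x₀ j z)

/-- The density `√(det g_{ij})` of the Riemannian volume in the chart at `x₀`. -/
def volumeDensity (g : Metric k M) (x₀ : M) (z : EuclideanSpace ℝ (Fin k)) : ℝ :=
  √(gramMatrix g x₀ z).det

/-- The Riemannian volume of the domain of the chart at `x₀`, extended by `0` to `M`:
`√(det g_{ij}) dz¹ ⋯ dzᵏ` transported by the chart. -/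
def chartVolume [MeasurableSpace M] (g : Metric k M) (x₀ : M) : Measure M :=
  ((volume.restrict (extChartAt (𝓡∂ k) x₀).target).withDensity
    fun z ↦ ENNReal.ofReal (volumeDensity g x₀ z)).map (extChartAt (𝓡∂ k) x₀).symm

/-- The Riemannian volume measure of `(M, g)`: the least measure that dominates the Riemannian
volumes of all the chart domains. As these agree on overlaps, it is the measure that restricts to
`chartVolume g x₀` on the domain of the chart at `x₀`, for every `x₀`. -/
def riemannianVolume [MeasurableSpace M] (g : Metric k M) : Measure M :=
  ⨆ x₀ : M, chartVolume g x₀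

/-- The metric at `p`, as a bilinear form on the tangent space at `p`. -/
def metricForm (g : Metric k M) (p : M) : LinearMap.BilinForm ℝ (TangentSpace (𝓡∂ k) p) :=
  LinearMap.mk₂ ℝ (fun v w ↦ g.inner p v w) (by simp) (by simp) (by simp) (by simp)

theorem metricForm_nondegenerate (g : Metric k M) (p : M) : (metricForm g p).Nondegenerate := by
  have key : ∀ v : TangentSpace (𝓡∂ k) p, g.inner p v v = 0 → v = 0 := fun v hv ↦ by
    by_contra h
    exact (g.pos p v h).ne' hv
  exact ⟨fun v hv ↦ key v (hv v), fun v hv ↦ key v (hv v)⟩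

instance finiteDimensional_tangentSpace (p : M) :
    FiniteDimensional ℝ (TangentSpace (𝓡∂ k) p) :=
  inferInstanceAs (FiniteDimensional ℝ (EuclideanSpace ℝ (Fin k)))

/-- The gradient of `u` at `p`: the tangent vector `∇u` with `g(∇u, v) = du(v)` for all `v`. -/
def gradient (g : Metric k M) (u : M → ℝ) (p : M) : TangentSpace (𝓡∂ k) p :=
  ((metricForm g p).toDual (metricForm_nondegenerate g p)).symm (differential u p).toLinearMap

/-- The squared norm `|∇u|²_g` of the gradient. -/
def gradNormSq (g : Metric k M) (u : M → ℝ) (p : M) : ℝ :=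
  g.inner p (gradient g u p) (gradient g u p)

/-- The Laplace-Beltrami operator
`Δ_g u = (det g)^{-1/2} ∑ᵢ ∂ᵢ ((det g)^{1/2} ∑ⱼ g^{ij} ∂ⱼ u)` in the chart at `x₀`. -/
def chartLaplacian (g : Metric k M) (x₀ : M) (u : M → ℝ) (z : EuclideanSpace ℝ (Fin k)) : ℝ :=
  (volumeDensity g x₀ z)⁻¹ * ∑ i, partialDeriv i (fun y ↦ volumeDensity g x₀ y *
    ∑ j, (gramMatrix g x₀ y)⁻¹ i j * partialDeriv j (inChart x₀ u) y) z

/-- `Δ_g u = f` on `M`. (The coordinate expression of `Δ_g u` does not depend on the chart.) -/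
def HasLaplacian (g : Metric k M) (u f : M → ℝ) : Prop :=
  ∀ x₀ : M, ∀ z ∈ (extChartAt (𝓡∂ k) x₀).target, chartLaplacian g x₀ u z = inChart x₀ f z

/-- `w` is a classical solution of `-Δ_g w - α w = lam w` in `M`, `w = 0` on `∂M`. -/
structure SolvesDirichlet (g : Metric k M) (α lam : ℝ) (w : M → ℝ) : Prop where
  contMDiff : ContMDiff (𝓡∂ k) 𝓘(ℝ, ℝ) 2 w
  equation : HasLaplacian g w (fun p ↦ -(α * w p) - lam * w p)
  boundary : ∀ p ∈ (𝓡∂ k).boundary M, w p = 0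

/-- `lam` is an eigenvalue of `-Δ_g` with Dirichlet boundary condition. -/
def IsDirichletEigenvalue (g : Metric k M) (lam : ℝ) : Prop :=
  ∃ w : M → ℝ, w ≠ 0 ∧ SolvesDirichlet g 0 lam w

/-- The first eigenvalue of `-Δ_g` with Dirichlet boundary condition (`⊤` if there is none, that
is, if `M` is empty). -/
def firstDirichletEigenvalue (g : Metric k M) : EReal :=
  sInf {l : EReal | ∃ lam : ℝ, IsDirichletEigenvalue g lam ∧ l = (lam : EReal)}

variable {n : ℕ}

/-- The normal space, in the tangent space of the sphere `𝕊ⁿ`, of a sphere-valued immersion `Φ` at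
the point with coordinates `z` in the chart at `x₀`: the orthogonal complement in `ℝⁿ⁺¹` of the
position vector `Φ` and the image `dΦ(TM)`, which is spanned by the `∂ᵢ Φ`. -/
def normalSpace (x₀ : M) (Φ : M → Ambient n) (z : EuclideanSpace ℝ (Fin k)) :
    Submodule ℝ (Ambient n) :=
  (Submodule.span ℝ (insert (inChart x₀ Φ z)
    (range fun i : Fin k ↦ partialDeriv i (inChart x₀ Φ) z)))ᗮ

/-- The second fundamental form `II(∂ᵢ, ∂ⱼ)` of a sphere-valued immersion `Φ`, in the chart at
`x₀`: the component of `∂ᵢ ∂ⱼ Φ` normal to `Φ` in `𝕊ⁿ`. -/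
def secondFundamentalForm (x₀ : M) (Φ : M → Ambient n) (i j : Fin k)
    (z : EuclideanSpace ℝ (Fin k)) : Ambient n :=
  (normalSpace x₀ Φ z).starProjection
    (partialDeriv i (fun y ↦ partialDeriv j (inChart x₀ Φ) y) z)

/-- The mean curvature vector of an isometric immersion `Φ : (M, g) → 𝕊ⁿ`, the trace
`∑ g^{ij} II(∂ᵢ, ∂ⱼ)` of the second fundamental form. -/
def meanCurvature (g : Metric k M) (x₀ : M) (Φ : M → Ambient n)
    (z : EuclideanSpace ℝ (Fin k)) : Ambient n :=
  ∑ i, ∑ j, (gramMatrix g x₀ z)⁻¹ i j • secondFundamentalForm x₀ Φ i j z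

/-- `Φ : (M, g) → 𝔹ⁿ(r)` is an isometric minimal immersion with free boundary: `Φ` is smooth,
preserves the Riemannian metric, maps `∂M` to `∂𝔹ⁿ(r)`, has zero mean curvature, and meets
`∂𝔹ⁿ(r)` orthogonally, that is, `dΦ` maps the conormal directions of `∂M` to vectors orthogonal to
`T ∂𝔹ⁿ(r)` (which at `x` consists of the `y` with `⟨x, y⟩ = 0` and `y 0 = 0`). -/
structure IsFreeBoundaryMinimalImmersion (g : Metric k M) (r : ℝ) (Φ : M → Ambient n) :
    Prop where
  contMDiff : ContMDiff (𝓡∂ k) 𝓘(ℝ, Ambient n) ∞ Φ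
  isometric : ∀ (p : M) (v w : TangentSpace (𝓡∂ k) p),
    inner ℝ (differential Φ p v) (differential Φ p w) = g.inner p v w
  mem_cap : ∀ p, Φ p ∈ cap n r
  mem_capBoundary : ∀ p ∈ (𝓡∂ k).boundary M, Φ p ∈ capBoundary n r
  minimal : ∀ x₀ : M, ∀ z ∈ (extChartAt (𝓡∂ k) x₀).target, meanCurvature g x₀ Φ z = 0
  orthogonal : ∀ p ∈ (𝓡∂ k).boundary M, ∀ v : TangentSpace (𝓡∂ k) p,
    (∀ t ∈ boundaryTangent p, g.inner p v t = 0) →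
      ∀ y : Ambient n, inner ℝ (Φ p) y = 0 → y 0 = 0 → inner ℝ (differential Φ p v) y = 0

end SphericalCap

end

/-! The proof is Barta's argument: a positive strict supersolution bounds the Dirichlet spectrum
from below. Minimality in the unit sphere gives `Δ_g Φ = -k Φ` for the position vector, hence for
its coordinate `Φ⁰`. Since `r < π/2`, `Φ⁰ ≥ cos r > 0`, so for any `0 < a < cos r` the function `f =
Φ⁰ - a` is positive up to the boundary. From `Φ⁰ ≤ 1` it follows that `(1 + a) f ≤ Φ⁰`, that is,
`-Δ_g f = k Φ⁰ ≥ k (1 + a) f`. The shift by `a` is what makes the final inequality strict.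

This supersolution is used twice. For a classical solution `w` that is positive somewhere, the
multiple `m f` with `m = max (w / f)` touches `w` from above at an interior point, where the second
derivative test yields `k (1 + a) ≤ α + lam` (`le_of_solvesDirichlet`). For smooth `u`, the weak
equation for `f` is tested with `u² / f`; completing a square gives the Rayleigh bound with the same
constant (`mul_integral_sq_le`). Neither argument needs the existence of an eigenfunction.

The supporting work is `divergence_laplacianFlux` (the equation for `Φ` in coordinates),
`restrict_riemannianVolume` (integrals in a chart) and `integral_partialDeriv_eq_zero` (the
divergence theorem on the half space), combined by a partition of unity in
`integral_inner_gradient`. -/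

noncomputable section

namespace SphericalCap

/-! ### Calculus of partial derivatives within the half space -/

section ChartCalculus

variable {k : ℕ} [NeZero k] {M : Type*} [TopologicalSpace M]
  [ChartedSpace (EuclideanHalfSpace k) M]
  {F : Type*} [NormedAddCommGroup F] [NormedSpace ℝ F]

theorem uniqueDiffWithinAt_halfSpace {z : EuclideanSpace ℝ (Fin k)} (hz : z ∈ range (𝓡∂ k)) :
    UniqueDiffWithinAt ℝ (range (𝓡∂ k)) z :=
  (𝓡∂ k).uniqueDiffOn z hz

theorem target_subset_halfSpace {x₀ : M} {z : EuclideanSpace ℝ (Fin k)}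
    (hz : z ∈ (extChartAt (𝓡∂ k) x₀).target) : z ∈ range (𝓡∂ k) :=
  extChartAt_target_subset_range x₀ hz

theorem contDiffWithinAt_halfSpace {n : ℕ∞ω} {x₀ : M} {f : EuclideanSpace ℝ (Fin k) → F}
    (hf : ContDiffOn ℝ n f (extChartAt (𝓡∂ k) x₀).target) {z : EuclideanSpace ℝ (Fin k)}
    (hz : z ∈ (extChartAt (𝓡∂ k) x₀).target) : ContDiffWithinAt ℝ n f (range (𝓡∂ k)) z :=
  (hf z hz).mono_of_mem_nhdsWithin (extChartAt_target_mem_nhdsWithin_of_mem hz)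

theorem differentiableWithinAt_halfSpace {n : ℕ∞ω} {x₀ : M} {f : EuclideanSpace ℝ (Fin k) → F}
    (hf : ContDiffOn ℝ n f (extChartAt (𝓡∂ k) x₀).target) (hn : n ≠ 0)
    {z : EuclideanSpace ℝ (Fin k)} (hz : z ∈ (extChartAt (𝓡∂ k) x₀).target) :
    DifferentiableWithinAt ℝ f (range (𝓡∂ k)) z :=
  (contDiffWithinAt_halfSpace hf hz).differentiableWithinAt hn

theorem contDiffOn_inChart {n : ℕ∞ω} [IsManifold (𝓡∂ k) n M] {f : M → F}
    (hf : ContMDiff (𝓡∂ k) 𝓘(ℝ, F) n f) (x₀ : M) :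
    ContDiffOn ℝ n (inChart x₀ f) (extChartAt (𝓡∂ k) x₀).target :=
  contMDiffOn_iff_contDiffOn.1 (hf.comp_contMDiffOn (contMDiffOn_extChartAt_symm x₀))

/-- The target of a chart is a neighbourhood of each of its points within the half space, so
differentiating within either set gives the same result. -/
theorem contDiffOn_partialDeriv {m n : ℕ∞ω} {x₀ : M} {f : EuclideanSpace ℝ (Fin k) → F}
    (hf : ContDiffOn ℝ n f (extChartAt (𝓡∂ k) x₀).target) (hmn : m + 1 ≤ n) (i : Fin k) :
    ContDiffOn ℝ m (partialDeriv i f) (extChartAt (𝓡∂ k) x₀).target := by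
  have h1 := hf.fderivWithin (uniqueDiffOn_extChartAt_target x₀) hmn
  have h2 : ContDiffOn ℝ m (fun z ↦ fderivWithin ℝ f (extChartAt (𝓡∂ k) x₀).target z
      (EuclideanSpace.single i 1)) (extChartAt (𝓡∂ k) x₀).target :=
    h1.clm_apply contDiffOn_const
  refine h2.congr fun z hz ↦ ?_
  have hn : n ≠ 0 := by
    rintro rfl
    exact absurd hmn (by simp)
  rw [partialDeriv, fderivWithin_of_mem_nhdsWithin (extChartAt_target_mem_nhdsWithin_of_mem hz)
    (uniqueDiffWithinAt_halfSpace (target_subset_halfSpace hz))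
    ((hf z hz).differentiableWithinAt hn)]

theorem partialDeriv_congr {x₀ : M} {f f' : EuclideanSpace ℝ (Fin k) → F}
    (h : EqOn f f' (extChartAt (𝓡∂ k) x₀).target) {z : EuclideanSpace ℝ (Fin k)}
    (hz : z ∈ (extChartAt (𝓡∂ k) x₀).target) (i : Fin k) :
    partialDeriv i f z = partialDeriv i f' z := by
  unfold partialDeriv
  rw [Filter.EventuallyEq.fderivWithin_eq _ (h hz)]
  filter_upwards [extChartAt_target_mem_nhdsWithin_of_mem hz] with y hy using h hy

variable {z : EuclideanSpace ℝ (Fin k)}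

theorem partialDeriv_const (i : Fin k) (c : F) :
    partialDeriv i (fun _ : EuclideanSpace ℝ (Fin k) ↦ c) z = 0 := by
  simp [partialDeriv]

theorem partialDeriv_sub (hz : z ∈ range (𝓡∂ k)) {a b : EuclideanSpace ℝ (Fin k) → F}
    (ha : DifferentiableWithinAt ℝ a (range (𝓡∂ k)) z)
    (hb : DifferentiableWithinAt ℝ b (range (𝓡∂ k)) z) (i : Fin k) :
    partialDeriv i (fun y ↦ a y - b y) z = partialDeriv i a z - partialDeriv i b z := by
  simp only [partialDeriv, fderivWithin_fun_sub (uniqueDiffWithinAt_halfSpace hz) ha hb]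
  rfl

theorem partialDeriv_neg (hz : z ∈ range (𝓡∂ k)) (a : EuclideanSpace ℝ (Fin k) → F)
    (i : Fin k) : partialDeriv i (fun y ↦ -a y) z = -partialDeriv i a z := by
  simp only [partialDeriv, fderivWithin_fun_neg (uniqueDiffWithinAt_halfSpace hz)]
  rfl

theorem partialDeriv_mul (hz : z ∈ range (𝓡∂ k)) {a b : EuclideanSpace ℝ (Fin k) → ℝ}
    (ha : DifferentiableWithinAt ℝ a (range (𝓡∂ k)) z)
    (hb : DifferentiableWithinAt ℝ b (range (𝓡∂ k)) z) (i : Fin k) :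
    partialDeriv i (fun y ↦ a y * b y) z =
      partialDeriv i a z * b z + a z * partialDeriv i b z := by
  simp only [partialDeriv, fderivWithin_fun_mul (uniqueDiffWithinAt_halfSpace hz) ha hb]
  simp; ring

theorem partialDeriv_smul (hz : z ∈ range (𝓡∂ k)) {a : EuclideanSpace ℝ (Fin k) → ℝ}
    {b : EuclideanSpace ℝ (Fin k) → F}
    (ha : DifferentiableWithinAt ℝ a (range (𝓡∂ k)) z)
    (hb : DifferentiableWithinAt ℝ b (range (𝓡∂ k)) z) (i : Fin k) :
    partialDeriv i (fun y ↦ a y • b y) z =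
      partialDeriv i a z • b z + a z • partialDeriv i b z := by
  simp only [partialDeriv, fderivWithin_fun_smul (uniqueDiffWithinAt_halfSpace hz) ha hb]
  simp [add_comm]

theorem partialDeriv_const_smul (hz : z ∈ range (𝓡∂ k)) {b : EuclideanSpace ℝ (Fin k) → F}
    (c : ℝ) (hb : DifferentiableWithinAt ℝ b (range (𝓡∂ k)) z) (i : Fin k) :
    partialDeriv i (fun y ↦ c • b y) z = c • partialDeriv i b z := by
  rw [partialDeriv_smul hz (differentiableWithinAt_const c) hb]
  simp [partialDeriv_const]

theorem partialDeriv_sub_const_mul (hz : z ∈ range (𝓡∂ k))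
    {a b : EuclideanSpace ℝ (Fin k) → ℝ}
    (ha : DifferentiableWithinAt ℝ a (range (𝓡∂ k)) z)
    (hb : DifferentiableWithinAt ℝ b (range (𝓡∂ k)) z) (c : ℝ) (i : Fin k) :
    partialDeriv i (fun y ↦ a y - c * b y) z = partialDeriv i a z - c * partialDeriv i b z := by
  refine (partialDeriv_sub hz ha (hb.const_smul c) i).trans ?_
  exact congrArg (partialDeriv i a z - ·) (partialDeriv_const_smul hz c hb i)

theorem partialDeriv_sum (hz : z ∈ range (𝓡∂ k)) {ι : Type*} (s : Finset ι)
    {a : ι → EuclideanSpace ℝ (Fin k) → F}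
    (ha : ∀ j ∈ s, DifferentiableWithinAt ℝ (a j) (range (𝓡∂ k)) z) (i : Fin k) :
    partialDeriv i (fun y ↦ ∑ j ∈ s, a j y) z = ∑ j ∈ s, partialDeriv i (a j) z := by
  simp only [partialDeriv, fderivWithin_fun_sum (uniqueDiffWithinAt_halfSpace hz) ha]
  simp

theorem partialDeriv_clm (hz : z ∈ range (𝓡∂ k)) {G : Type*} [NormedAddCommGroup G]
    [NormedSpace ℝ G] (A : F →L[ℝ] G) {b : EuclideanSpace ℝ (Fin k) → F}
    (hb : DifferentiableWithinAt ℝ b (range (𝓡∂ k)) z) (i : Fin k) :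
    partialDeriv i (fun y ↦ A (b y)) z = A (partialDeriv i b z) := by
  have h := (A.hasFDerivAt.comp_hasFDerivWithinAt z hb.hasFDerivWithinAt).fderivWithin
    (uniqueDiffWithinAt_halfSpace hz)
  simp only [partialDeriv]
  change fderivWithin ℝ (A ∘ b) _ _ _ = _
  rw [h]; rfl

theorem partialDeriv_inner (hz : z ∈ range (𝓡∂ k)) {V : Type*} [NormedAddCommGroup V]
    [InnerProductSpace ℝ V] {a b : EuclideanSpace ℝ (Fin k) → V}
    (ha : DifferentiableWithinAt ℝ a (range (𝓡∂ k)) z)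
    (hb : DifferentiableWithinAt ℝ b (range (𝓡∂ k)) z) (i : Fin k) :
    partialDeriv i (fun y ↦ inner ℝ (a y) (b y)) z =
      inner ℝ (partialDeriv i a z) (b z) + inner ℝ (a z) (partialDeriv i b z) := by
  have h := (ha.hasFDerivWithinAt.inner ℝ hb.hasFDerivWithinAt).fderivWithin
    (uniqueDiffWithinAt_halfSpace hz)
  simp only [partialDeriv, h]
  simp [fderivInnerCLM_apply, add_comm]

theorem partialDeriv_comp (hz : z ∈ range (𝓡∂ k)) {a : EuclideanSpace ℝ (Fin k) → ℝ}
    {h : ℝ → ℝ} {h' : ℝ} (hh : HasDerivAt h h' (a z))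
    (ha : DifferentiableWithinAt ℝ a (range (𝓡∂ k)) z) (i : Fin k) :
    partialDeriv i (fun y ↦ h (a y)) z = h' * partialDeriv i a z := by
  have := (hh.comp_hasFDerivWithinAt z ha.hasFDerivWithinAt).fderivWithin
    (uniqueDiffWithinAt_halfSpace hz)
  simp only [partialDeriv]
  change fderivWithin ℝ (h ∘ a) _ _ _ = _
  rw [this]; simp

/-- Jacobi's formula, from the Leibniz expansion differentiated one column at a time. -/
theorem partialDeriv_det (hz : z ∈ range (𝓡∂ k)) {ι : Type*} [Fintype ι] [DecidableEq ι]
    {A : EuclideanSpace ℝ (Fin k) → Matrix ι ι ℝ}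
    (hA : ∀ a b, DifferentiableWithinAt ℝ (fun y ↦ A y a b) (range (𝓡∂ k)) z) (i : Fin k) :
    partialDeriv i (fun y ↦ (A y).det) z =
      ∑ a, ∑ b, (A z).adjugate a b * partialDeriv i (fun y ↦ A y b a) z := by
  have h1 : ∀ σ : Equiv.Perm ι, HasFDerivWithinAt (fun y ↦ ∏ a, A y (σ a) a)
      (∑ a, (∏ b ∈ Finset.univ.erase a, A z (σ b) b) •
        fderivWithin ℝ (fun y ↦ A y (σ a) a) (range (𝓡∂ k)) z) (range (𝓡∂ k)) z := fun σ ↦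
    HasFDerivWithinAt.finsetProd fun a _ ↦ (hA (σ a) a).hasFDerivWithinAt
  have h2 : HasFDerivWithinAt (fun y ↦ (A y).det)
      (∑ σ : Equiv.Perm ι, ((Equiv.Perm.sign σ : ℤ) : ℝ) •
        ∑ a, (∏ b ∈ Finset.univ.erase a, A z (σ b) b) •
          fderivWithin ℝ (fun y ↦ A y (σ a) a) (range (𝓡∂ k)) z) (range (𝓡∂ k)) z := by
    simp only [Matrix.det_apply']
    exact HasFDerivWithinAt.fun_sum fun σ _ ↦ (h1 σ).const_mul _
  -- Both sides are the determinant of `A z` with column `a` replaced by its derivative: by Cramer's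
  -- rule on the left, by expansion on the right.
  have h3 : ∀ a, ∑ b, (A z).adjugate a b * partialDeriv i (fun y ↦ A y b a) z =
      ∑ σ : Equiv.Perm ι, ((Equiv.Perm.sign σ : ℤ) : ℝ) *
        ((∏ b ∈ Finset.univ.erase a, A z (σ b) b) * partialDeriv i (fun y ↦ A y (σ a) a) z) := by
    intro a
    have := Matrix.cramer_apply (A z) (fun b ↦ partialDeriv i (fun y ↦ A y b a) z) a
    rw [Matrix.cramer_eq_adjugate_mulVec] at this
    simp only [Matrix.mulVec, dotProduct] at this
    rw [this, Matrix.det_apply']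
    refine Finset.sum_congr rfl fun σ _ ↦ ?_
    rw [← Finset.prod_erase_mul _ _ (Finset.mem_univ a)]
    congr 1
    congr 1
    · refine Finset.prod_congr rfl fun b hb ↦ ?_
      rw [Matrix.updateCol_ne (Finset.ne_of_mem_erase hb)]
    · simp
  rw [Finset.sum_congr rfl fun a _ ↦ h3 a, Finset.sum_comm]
  simp only [partialDeriv, h2.fderivWithin (uniqueDiffWithinAt_halfSpace hz)]
  simp [Finset.mul_sum]

/-- Symmetry persists at boundary points because these are limits of interior points of the half
space. -/
theorem partialDeriv_comm {x₀ : M} {f : EuclideanSpace ℝ (Fin k) → F}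
    (hf : ContDiffOn ℝ 2 f (extChartAt (𝓡∂ k) x₀).target)
    (hz : z ∈ (extChartAt (𝓡∂ k) x₀).target) (i j : Fin k) :
    partialDeriv i (fun y ↦ partialDeriv j f y) z =
      partialDeriv j (fun y ↦ partialDeriv i f y) z := by
  have hzH := target_subset_halfSpace hz
  have hcl : z ∈ closure (interior (range (𝓡∂ k))) :=
    ((𝓡∂ k).range_subset_closure_interior) hzH
  have hfz := contDiffWithinAt_halfSpace hf hz
  have hsymm := hfz.isSymmSndFDerivWithinAt (by simp) (𝓡∂ k).uniqueDiffOn hcl hzH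
  have hd : DifferentiableWithinAt ℝ (fderivWithin ℝ f (range (𝓡∂ k))) (range (𝓡∂ k)) z :=
    (hfz.fderivWithin_right (m := 1) (𝓡∂ k).uniqueDiffOn (by norm_num) hzH).differentiableWithinAt
      (by simp)
  have key : ∀ i j, partialDeriv i (fun y ↦ partialDeriv j f y) z =
      fderivWithin ℝ (fderivWithin ℝ f (range (𝓡∂ k))) (range (𝓡∂ k)) z
        (EuclideanSpace.single i 1) (EuclideanSpace.single j 1) := fun i j ↦ by
    simp only [partialDeriv]
    rw [fderivWithin_clm_apply (uniqueDiffWithinAt_halfSpace hzH) hd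
      (differentiableWithinAt_const _)]
    simp
  rw [key, key, hsymm]

end ChartCalculus

theorem contDiffOn_det {E : Type*} [NormedAddCommGroup E] [NormedSpace ℝ E] {s : Set E}
    {m : ℕ∞ω} {ι : Type*} [Fintype ι] [DecidableEq ι] {A : E → Matrix ι ι ℝ}
    (hA : ∀ i j, ContDiffOn ℝ m (fun y ↦ A y i j) s) :
    ContDiffOn ℝ m (fun y ↦ (A y).det) s := by
  simp only [Matrix.det_apply']
  exact ContDiffOn.sum fun σ _ ↦ contDiffOn_const.mul (contDiffOn_prod fun i _ ↦ hA _ _)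

/-! ### The metric and the gradient in coordinates -/

section CoordinateMetric

variable {k n : ℕ} [NeZero k] {M : Type*} [TopologicalSpace M]
  [ChartedSpace (EuclideanHalfSpace k) M] [IsManifold (𝓡∂ k) ∞ M]
  {F : Type*} [NormedAddCommGroup F] [NormedSpace ℝ F]
  {x₀ : M} {z : EuclideanSpace ℝ (Fin k)}

theorem differential_coordVector {u : M → F}
    (hu : MDifferentiableAt (𝓡∂ k) 𝓘(ℝ, F) u ((extChartAt (𝓡∂ k) x₀).symm z))
    (hz : z ∈ (extChartAt (𝓡∂ k) x₀).target) (i : Fin k) :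
    differential u ((extChartAt (𝓡∂ k) x₀).symm z) (coordVector x₀ i z) =
      partialDeriv i (inChart x₀ u) z := by
  have : IsManifold (𝓡∂ k) 1 M := IsManifold.of_le (n := ∞) (by simp)
  have h := mfderiv_comp_mfderivWithin (I := 𝓘(ℝ, EuclideanSpace ℝ (Fin k))) z hu
    (mdifferentiableWithinAt_extChartAt_symm (I := 𝓡∂ k) (x := x₀) hz)
    (uniqueDiffWithinAt_halfSpace (target_subset_halfSpace hz)).uniqueMDiffWithinAt
  rw [mfderivWithin_eq_fderivWithin] at h
  have h' := congrArg (fun A ↦ A (EuclideanSpace.single i (1 : ℝ))) h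
  exact h'.symm

omit [IsManifold (𝓡∂ k) ∞ M] in
theorem sum_smul_coordVector (c : EuclideanSpace ℝ (Fin k)) :
    ∑ i, c i • coordVector x₀ i z =
      mfderivWithin 𝓘(ℝ, EuclideanSpace ℝ (Fin k)) (𝓡∂ k) (extChartAt (𝓡∂ k) x₀).symm
        (range (𝓡∂ k)) z c := by
  have hc : c = ∑ i, c i • EuclideanSpace.single i (1 : ℝ) := by
    ext j; simp [Finset.sum_apply, Pi.single_apply]
  conv_rhs => rw [hc]
  exact (map_sum (mfderivWithin 𝓘(ℝ, EuclideanSpace ℝ (Fin k)) (𝓡∂ k)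
    (extChartAt (𝓡∂ k) x₀).symm (range (𝓡∂ k)) z).toLinearMap _ _).symm ▸
    (Finset.sum_congr rfl fun i _ ↦ ((mfderivWithin 𝓘(ℝ, EuclideanSpace ℝ (Fin k)) (𝓡∂ k)
      (extChartAt (𝓡∂ k) x₀).symm (range (𝓡∂ k)) z).map_smul _ _).symm)

/-- The differential of the inverse chart is invertible, also at boundary points, so the coordinate
vectors form a basis; the next lemma is the independence. -/
theorem exists_eq_sum_coordVector (hz : z ∈ (extChartAt (𝓡∂ k) x₀).target)
    (v : TangentSpace (𝓡∂ k) ((extChartAt (𝓡∂ k) x₀).symm z)) :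
    ∃ c : EuclideanSpace ℝ (Fin k), v = ∑ i, c i • coordVector x₀ i z := by
  have : IsManifold (𝓡∂ k) 1 M := IsManifold.of_le (n := ∞) (by simp)
  obtain ⟨A, hA⟩ := isInvertible_mfderivWithin_extChartAt_symm (I := 𝓡∂ k) hz
  refine ⟨A.symm v, ?_⟩
  refine (A.apply_symm_apply v).symm.trans ?_
  exact (DFunLike.congr_fun hA _).trans (sum_smul_coordVector (A.symm v)).symm

theorem eq_zero_of_sum_coordVector (hz : z ∈ (extChartAt (𝓡∂ k) x₀).target)
    {c : EuclideanSpace ℝ (Fin k)} (hc : ∑ i, c i • coordVector x₀ i z = 0) : c = 0 := by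
  have : IsManifold (𝓡∂ k) 1 M := IsManifold.of_le (n := ∞) (by simp)
  obtain ⟨A, hA⟩ := isInvertible_mfderivWithin_extChartAt_symm (I := 𝓡∂ k) hz
  rw [sum_smul_coordVector, ← hA] at hc
  exact A.map_eq_zero_iff.1 hc

variable (g : Metric k M)

theorem gramMatrix_apply (i j : Fin k) : gramMatrix g x₀ z i j =
    g.inner ((extChartAt (𝓡∂ k) x₀).symm z) (coordVector x₀ i z) (coordVector x₀ j z) := rfl

theorem posDef_gramMatrix (hz : z ∈ (extChartAt (𝓡∂ k) x₀).target) :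
    (gramMatrix g x₀ z).PosDef := by
  refine Matrix.PosDef.of_dotProduct_mulVec_pos ?_ fun c hc ↦ ?_
  · ext i j
    simp only [Matrix.conjTranspose_apply, gramMatrix_apply, star_trivial]
    exact g.symm _ _ _
  · have hne : ∑ i, c i • coordVector x₀ i z ≠ 0 := fun h ↦ hc <| by
      have := eq_zero_of_sum_coordVector hz (c := WithLp.toLp 2 c) h
      simpa using this
    refine (g.pos _ _ hne).trans_eq ?_
    simp only [map_sum, map_smul, dotProduct, Matrix.mulVec, gramMatrix_apply, star_trivial,
      sum_apply, smul_apply, smul_eq_mul, Finset.mul_sum]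
    rw [Finset.sum_comm]
    exact Finset.sum_congr rfl fun i _ ↦ Finset.sum_congr rfl fun j _ ↦ by ring

theorem det_gramMatrix_pos (hz : z ∈ (extChartAt (𝓡∂ k) x₀).target) :
    0 < (gramMatrix g x₀ z).det := (posDef_gramMatrix g hz).det_pos

theorem volumeDensity_pos (hz : z ∈ (extChartAt (𝓡∂ k) x₀).target) :
    0 < volumeDensity g x₀ z := Real.sqrt_pos.2 (det_gramMatrix_pos g hz)

theorem gramMatrix_symm (i j : Fin k) : gramMatrix g x₀ z i j = gramMatrix g x₀ z j i :=
  g.symm _ _ _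

theorem inv_gramMatrix_symm (hz : z ∈ (extChartAt (𝓡∂ k) x₀).target) (i j : Fin k) :
    (gramMatrix g x₀ z)⁻¹ i j = (gramMatrix g x₀ z)⁻¹ j i := by
  have h := (posDef_gramMatrix g hz).inv.isHermitian.apply i j
  simpa using h.symm

theorem sum_inv_gramMatrix_mul (hz : z ∈ (extChartAt (𝓡∂ k) x₀).target) (i l : Fin k) :
    ∑ j, (gramMatrix g x₀ z)⁻¹ i j * gramMatrix g x₀ z j l = if i = l then 1 else 0 := by
  have h := Matrix.nonsing_inv_mul (gramMatrix g x₀ z) (det_gramMatrix_pos g hz).ne'.isUnit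
  have := congrFun (congrFun h i) l
  rwa [Matrix.mul_apply, Matrix.one_apply] at this

/-! The gradient in coordinates. -/

theorem inner_gradient (u : M → ℝ) (p : M) (v : TangentSpace (𝓡∂ k) p) :
    g.inner p (gradient g u p) v = differential u p v :=
  LinearMap.BilinForm.apply_toDual_symm_apply (hB := metricForm_nondegenerate g p)
    (differential u p).toLinearMap v

theorem gradient_eq_of_inner {u : M → ℝ} {p : M} {X : TangentSpace (𝓡∂ k) p}
    (h : ∀ v, g.inner p X v = differential u p v) : gradient g u p = X := by
  have h0 : g.inner p (gradient g u p - X) (gradient g u p - X) = 0 := by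
    rw [map_sub, sub_eq_zero, g.symm _ _ (gradient g u p), inner_gradient, g.symm _ _ X, h]
  by_contra hne
  exact (g.pos p _ (sub_ne_zero.2 hne)).ne' h0

theorem gradient_eq_sum {u : M → ℝ}
    (hu : MDifferentiableAt (𝓡∂ k) 𝓘(ℝ, ℝ) u ((extChartAt (𝓡∂ k) x₀).symm z))
    (hz : z ∈ (extChartAt (𝓡∂ k) x₀).target) :
    gradient g u ((extChartAt (𝓡∂ k) x₀).symm z) =
      ∑ i, (∑ j, (gramMatrix g x₀ z)⁻¹ i j * partialDeriv j (inChart x₀ u) z) •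
        coordVector x₀ i z := by
  refine gradient_eq_of_inner g fun v ↦ ?_
  obtain ⟨c, rfl⟩ := exists_eq_sum_coordVector hz v
  simp only [map_sum, map_smul, sum_apply, smul_apply, smul_eq_mul,
    ← gramMatrix_apply, differential_coordVector hu hz]
  refine Finset.sum_congr rfl fun l _ ↦ ?_
  congr 1
  calc ∑ i, (∑ j, (gramMatrix g x₀ z)⁻¹ i j * partialDeriv j (inChart x₀ u) z) *
        gramMatrix g x₀ z i l
      = ∑ j, partialDeriv j (inChart x₀ u) z *
          ∑ i, (gramMatrix g x₀ z)⁻¹ j i * gramMatrix g x₀ z i l := by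
        simp only [Finset.sum_mul, Finset.mul_sum]
        rw [Finset.sum_comm]
        refine Finset.sum_congr rfl fun j _ ↦ Finset.sum_congr rfl fun i _ ↦ ?_
        rw [inv_gramMatrix_symm g hz i j]; ring
    _ = partialDeriv l (inChart x₀ u) z := by
        simp [sum_inv_gramMatrix_mul g hz]

theorem inner_gradient_gradient {u w : M → ℝ}
    (hu : MDifferentiableAt (𝓡∂ k) 𝓘(ℝ, ℝ) u ((extChartAt (𝓡∂ k) x₀).symm z))
    (hw : MDifferentiableAt (𝓡∂ k) 𝓘(ℝ, ℝ) w ((extChartAt (𝓡∂ k) x₀).symm z))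
    (hz : z ∈ (extChartAt (𝓡∂ k) x₀).target) :
    g.inner ((extChartAt (𝓡∂ k) x₀).symm z) (gradient g u ((extChartAt (𝓡∂ k) x₀).symm z))
      (gradient g w ((extChartAt (𝓡∂ k) x₀).symm z)) =
      ∑ i, (∑ j, (gramMatrix g x₀ z)⁻¹ i j * partialDeriv j (inChart x₀ u) z) *
        partialDeriv i (inChart x₀ w) z := by
  rw [g.symm, inner_gradient, gradient_eq_sum g hu hz]
  simp only [map_sum, map_smul, smul_eq_mul, differential_coordVector hw hz]

/-! Smoothness of the coefficients of the metric. -/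

variable {Φ : M → Ambient n} {g}

/-- Because of this identity, smoothness, derivatives and the transformation law of the metric
coefficients can all be read off from `Φ`. -/
theorem gramMatrix_eq_inner
    (hΦ : MDifferentiable (𝓡∂ k) 𝓘(ℝ, Ambient n) Φ)
    (hiso : ∀ (p : M) (v w : TangentSpace (𝓡∂ k) p),
      inner ℝ (differential Φ p v) (differential Φ p w) = g.inner p v w)
    (hz : z ∈ (extChartAt (𝓡∂ k) x₀).target) (i j : Fin k) :
    gramMatrix g x₀ z i j =
      inner ℝ (partialDeriv i (inChart x₀ Φ) z) (partialDeriv j (inChart x₀ Φ) z) := by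
  rw [gramMatrix_apply, ← hiso, differential_coordVector (hΦ _) hz,
    differential_coordVector (hΦ _) hz]

variable {r : ℝ} (hΦ : IsFreeBoundaryMinimalImmersion g r Φ)
include hΦ

theorem IsFreeBoundaryMinimalImmersion.mdifferentiable :
    MDifferentiable (𝓡∂ k) 𝓘(ℝ, Ambient n) Φ :=
  hΦ.contMDiff.mdifferentiable (by simp)

theorem IsFreeBoundaryMinimalImmersion.gramMatrix_eq
    (hz : z ∈ (extChartAt (𝓡∂ k) x₀).target) (i j : Fin k) :
    gramMatrix g x₀ z i j =
      inner ℝ (partialDeriv i (inChart x₀ Φ) z) (partialDeriv j (inChart x₀ Φ) z) :=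
  gramMatrix_eq_inner hΦ.mdifferentiable hΦ.isometric hz i j

theorem IsFreeBoundaryMinimalImmersion.contDiffOn_gramMatrix (x₀ : M) (i j : Fin k) :
    ContDiffOn ℝ ∞ (fun y ↦ gramMatrix g x₀ y i j) (extChartAt (𝓡∂ k) x₀).target := by
  have h := contDiffOn_inChart hΦ.contMDiff x₀
  have h' := fun i ↦ contDiffOn_partialDeriv (m := ∞) h (by simp) i
  exact ((h' i).inner ℝ (h' j)).congr fun y hy ↦ hΦ.gramMatrix_eq hy i j

theorem IsFreeBoundaryMinimalImmersion.contDiffOn_volumeDensity (x₀ : M) :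
    ContDiffOn ℝ ∞ (volumeDensity g x₀) (extChartAt (𝓡∂ k) x₀).target :=
  (contDiffOn_det fun i j ↦ hΦ.contDiffOn_gramMatrix x₀ i j).sqrt
    fun _ hy ↦ (det_gramMatrix_pos g hy).ne'

theorem IsFreeBoundaryMinimalImmersion.contDiffOn_inv_gramMatrix (x₀ : M) (i j : Fin k) :
    ContDiffOn ℝ ∞ (fun y ↦ (gramMatrix g x₀ y)⁻¹ i j) (extChartAt (𝓡∂ k) x₀).target := by
  have h1 : ContDiffOn ℝ ∞ (fun y ↦ (gramMatrix g x₀ y).adjugate i j)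
      (extChartAt (𝓡∂ k) x₀).target := by
    simp only [Matrix.adjugate_apply]
    refine contDiffOn_det fun a b ↦ ?_
    by_cases ha : a = j
    · subst ha; simpa using contDiffOn_const
    · simpa [Matrix.updateRow_ne ha] using hΦ.contDiffOn_gramMatrix x₀ a b
  have h2 := (contDiffOn_det fun i j ↦ hΦ.contDiffOn_gramMatrix x₀ i j).inv
    fun _ hy ↦ (det_gramMatrix_pos g hy).ne'
  refine (h2.mul h1).congr fun y _ ↦ ?_
  simp [Matrix.inv_def]

end CoordinateMetric

/-! ### The equation `Δ_g Φ = -k Φ` -/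

section MinimalImmersion

variable {k n : ℕ} [NeZero k] {M : Type*} [TopologicalSpace M]
  [ChartedSpace (EuclideanHalfSpace k) M] [IsManifold (𝓡∂ k) ∞ M]

/-- The vector-valued coordinate flux `√(det g) ∑ⱼ g^{ij} ∂ⱼ Φ`, whose divergence is
`√(det g) Δ_g Φ`. -/
def laplacianFlux (g : Metric k M) (x₀ : M) (Φ : M → Ambient n) (i : Fin k)
    (z : EuclideanSpace ℝ (Fin k)) : Ambient n :=
  ∑ j, (volumeDensity g x₀ z * (gramMatrix g x₀ z)⁻¹ i j) • partialDeriv j (inChart x₀ Φ) z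

variable {x₀ : M} {z : EuclideanSpace ℝ (Fin k)} {g : Metric k M} {Φ : M → Ambient n} {r : ℝ}

namespace IsFreeBoundaryMinimalImmersion

variable (hΦ : IsFreeBoundaryMinimalImmersion g r Φ)
include hΦ

theorem contDiffOn_partialDeriv_inChart (x₀ : M) (i : Fin k) :
    ContDiffOn ℝ ∞ (partialDeriv i (inChart x₀ Φ)) (extChartAt (𝓡∂ k) x₀).target :=
  contDiffOn_partialDeriv (contDiffOn_inChart hΦ.contMDiff x₀) (by simp) i

theorem contDiffOn_coefficient (x₀ : M) (i j : Fin k) :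
    ContDiffOn ℝ ∞ (fun y ↦ volumeDensity g x₀ y * (gramMatrix g x₀ y)⁻¹ i j)
      (extChartAt (𝓡∂ k) x₀).target :=
  (hΦ.contDiffOn_volumeDensity x₀).mul (hΦ.contDiffOn_inv_gramMatrix x₀ i j)

theorem contDiffOn_laplacianFlux (x₀ : M) (i : Fin k) :
    ContDiffOn ℝ ∞ (laplacianFlux g x₀ Φ i) (extChartAt (𝓡∂ k) x₀).target :=
  ContDiffOn.sum fun j _ ↦ (hΦ.contDiffOn_coefficient x₀ i j).smul
    (hΦ.contDiffOn_partialDeriv_inChart x₀ j)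

/-- Up to the factor `√(det g)`, the fluxes are the basis of the tangent space dual to the `∂ₗ Φ`.
-/
theorem inner_laplacianFlux_partialDeriv (hz : z ∈ (extChartAt (𝓡∂ k) x₀).target)
    (i l : Fin k) : inner ℝ (laplacianFlux g x₀ Φ i z) (partialDeriv l (inChart x₀ Φ) z) =
      if i = l then volumeDensity g x₀ z else 0 := by
  simp only [laplacianFlux, sum_inner, real_inner_smul_left, ← hΦ.gramMatrix_eq hz, mul_assoc,
    ← Finset.mul_sum, sum_inv_gramMatrix_mul g hz]
  simp

theorem inner_partialDeriv_self (hz : z ∈ (extChartAt (𝓡∂ k) x₀).target) (i : Fin k) :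
    inner ℝ (partialDeriv i (inChart x₀ Φ) z) (inChart x₀ Φ z) = 0 := by
  have hzH := target_subset_halfSpace hz
  have hd := differentiableWithinAt_halfSpace (contDiffOn_inChart hΦ.contMDiff x₀) (by simp) hz
  have h := partialDeriv_inner hzH hd hd i
  have h1 : (fun y : EuclideanSpace ℝ (Fin k) ↦ inner ℝ (inChart x₀ Φ y) (inChart x₀ Φ y)) =
      fun _ ↦ (1 : ℝ) := by
    ext y
    rw [real_inner_self_eq_norm_sq, inChart, (hΦ.mem_cap _).1, one_pow]
  rw [h1, partialDeriv_const, real_inner_comm _ (inChart x₀ Φ z)] at h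
  linarith

theorem inner_laplacianFlux_self (hz : z ∈ (extChartAt (𝓡∂ k) x₀).target) (i : Fin k) :
    inner ℝ (laplacianFlux g x₀ Φ i z) (inChart x₀ Φ z) = 0 := by
  simp [laplacianFlux, sum_inner, real_inner_smul_left, hΦ.inner_partialDeriv_self hz]

/-- Jacobi's formula for `det g`, combined with the chain rule for the square root. -/
theorem partialDeriv_volumeDensity (hz : z ∈ (extChartAt (𝓡∂ k) x₀).target) (l : Fin k) :
    partialDeriv l (volumeDensity g x₀) z = 2⁻¹ * ∑ i, ∑ j,
      (volumeDensity g x₀ z * (gramMatrix g x₀ z)⁻¹ i j) *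
        partialDeriv l (fun y ↦ gramMatrix g x₀ y i j) z := by
  have hzH := target_subset_halfSpace hz
  have hG := fun i j ↦ differentiableWithinAt_halfSpace (hΦ.contDiffOn_gramMatrix x₀ i j)
    (by simp) hz
  have hdet := differentiableWithinAt_halfSpace
    (contDiffOn_det fun i j ↦ hΦ.contDiffOn_gramMatrix x₀ i j) (by simp) hz
  have h0 := det_gramMatrix_pos g hz
  have hsq := Real.mul_self_sqrt h0.le
  have hs := Real.sqrt_pos.2 h0
  have h1 := partialDeriv_comp hzH (Real.hasDerivAt_sqrt h0.ne') hdet l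
  change partialDeriv l (volumeDensity g x₀) z = _ at h1
  rw [h1, partialDeriv_det hzH hG, Finset.mul_sum, Finset.mul_sum]
  refine Finset.sum_congr rfl fun i _ ↦ ?_
  rw [Finset.mul_sum, Finset.mul_sum]
  refine Finset.sum_congr rfl fun j _ ↦ ?_
  have hadj : (gramMatrix g x₀ z).adjugate i j =
      (gramMatrix g x₀ z).det * (gramMatrix g x₀ z)⁻¹ i j := by
    rw [Matrix.inv_def, Matrix.smul_apply, smul_eq_mul, Ring.inverse_eq_inv', ← mul_assoc,
      mul_inv_cancel₀ h0.ne', one_mul]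
  have hsymm : (fun y ↦ gramMatrix g x₀ y j i) = fun y ↦ gramMatrix g x₀ y i j :=
    funext fun y ↦ gramMatrix_symm g j i
  rw [hadj, hsymm, volumeDensity]
  nth_rewrite 2 [← hsq]
  field_simp

/-- Differentiating the duality relation and summing gives `∂ₗ √(det g) - ∑ ⟨Wⁱ, ∂ₗ ∂ᵢ Φ⟩`, where
`Wⁱ` is the flux. By symmetry of `g^{ij}` the sum is `½ √(det g) ∑ g^{ij} ∂ₗ g_{ij}`, which is the
derivative of the density, so no Christoffel symbols are needed. -/
theorem inner_divergence_laplacianFlux_partialDeriv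
    (hz : z ∈ (extChartAt (𝓡∂ k) x₀).target) (l : Fin k) :
    inner ℝ (∑ i, partialDeriv i (laplacianFlux g x₀ Φ i) z)
      (partialDeriv l (inChart x₀ Φ) z) = 0 := by
  have hzH := target_subset_halfSpace hz
  have hW := fun i ↦ differentiableWithinAt_halfSpace (hΦ.contDiffOn_laplacianFlux x₀ i)
    (by simp) hz
  have he := fun i ↦ differentiableWithinAt_halfSpace
    (hΦ.contDiffOn_partialDeriv_inChart x₀ i) (by simp) hz
  have hcomm := fun i ↦ partialDeriv_comm
    ((contDiffOn_inChart hΦ.contMDiff x₀).of_le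
      (WithTop.coe_le_coe.2 (le_top : (2 : ℕ∞) ≤ ⊤))) hz i l
  have h1 : ∀ i, inner ℝ (partialDeriv i (laplacianFlux g x₀ Φ i) z)
      (partialDeriv l (inChart x₀ Φ) z) = (if i = l then partialDeriv l (volumeDensity g x₀) z
        else 0) - inner ℝ (laplacianFlux g x₀ Φ i z)
          (partialDeriv l (partialDeriv i (inChart x₀ Φ)) z) := fun i ↦ by
    have h := partialDeriv_inner hzH (hW i) (he l) i
    rw [partialDeriv_congr (fun y hy ↦ hΦ.inner_laplacianFlux_partialDeriv hy i l) hz] at h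
    rw [← hcomm i, eq_sub_iff_add_eq, ← h]
    split_ifs with hil
    · rw [hil]
    · exact partialDeriv_const _ _
  have hG : ∀ i j, partialDeriv l (fun y ↦ gramMatrix g x₀ y i j) z =
      inner ℝ (partialDeriv l (partialDeriv i (inChart x₀ Φ)) z)
          (partialDeriv j (inChart x₀ Φ) z) +
        inner ℝ (partialDeriv i (inChart x₀ Φ) z)
          (partialDeriv l (partialDeriv j (inChart x₀ Φ)) z) := fun i j ↦ by
    rw [partialDeriv_congr (fun y hy ↦ hΦ.gramMatrix_eq hy i j) hz]
    exact partialDeriv_inner hzH (he i) (he j) l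
  set c := fun i j ↦ volumeDensity g x₀ z * (gramMatrix g x₀ z)⁻¹ i j with hc
  have hcs : ∀ i j, c i j = c j i := fun i j ↦ by
    simp only [hc, inv_gramMatrix_symm g hz i j]
  have h2 : ∑ i, inner ℝ (laplacianFlux g x₀ Φ i z)
      (partialDeriv l (partialDeriv i (inChart x₀ Φ)) z) =
        ∑ i, ∑ j, c i j * inner ℝ (partialDeriv j (inChart x₀ Φ) z)
          (partialDeriv l (partialDeriv i (inChart x₀ Φ)) z) := by
    simp only [laplacianFlux, sum_inner, real_inner_smul_left, hc]
  have h3 : ∑ i, ∑ j, c i j * inner ℝ (partialDeriv j (inChart x₀ Φ) z)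
      (partialDeriv l (partialDeriv i (inChart x₀ Φ)) z) =
        ∑ i, ∑ j, c i j * inner ℝ (partialDeriv i (inChart x₀ Φ) z)
          (partialDeriv l (partialDeriv j (inChart x₀ Φ)) z) := by
    rw [Finset.sum_comm]
    exact Finset.sum_congr rfl fun i _ ↦ Finset.sum_congr rfl fun j _ ↦ by rw [hcs]
  rw [sum_inner, Finset.sum_congr rfl fun i _ ↦ h1 i, Finset.sum_sub_distrib,
    Finset.sum_ite_eq' Finset.univ l, if_pos (Finset.mem_univ l),
    hΦ.partialDeriv_volumeDensity hz, h2]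
  simp only [hG, mul_add, Finset.sum_add_distrib]
  rw [← h3]
  simp only [real_inner_comm (partialDeriv _ (inChart x₀ Φ) z)
    (partialDeriv l (partialDeriv _ (inChart x₀ Φ)) z)]
  simp only [hc]
  ring

/-- Differentiating `⟨Wⁱ, Φ⟩ = 0`, each of the `k` indices contributes `-⟨Wⁱ, ∂ᵢ Φ⟩ = -√(det g)`. -/
theorem inner_divergence_laplacianFlux_self (hz : z ∈ (extChartAt (𝓡∂ k) x₀).target) :
    inner ℝ (∑ i, partialDeriv i (laplacianFlux g x₀ Φ i) z) (inChart x₀ Φ z) =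
      -(k * volumeDensity g x₀ z) := by
  have hzH := target_subset_halfSpace hz
  have h1 : ∀ i, inner ℝ (partialDeriv i (laplacianFlux g x₀ Φ i) z) (inChart x₀ Φ z) =
      -volumeDensity g x₀ z := fun i ↦ by
    have h := partialDeriv_inner hzH
      (differentiableWithinAt_halfSpace (hΦ.contDiffOn_laplacianFlux x₀ i) (by simp) hz)
      (differentiableWithinAt_halfSpace (contDiffOn_inChart hΦ.contMDiff x₀) (by simp) hz) i
    rw [partialDeriv_congr (fun y hy ↦ hΦ.inner_laplacianFlux_self hy i) hz, partialDeriv_const,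
      hΦ.inner_laplacianFlux_partialDeriv hz, if_pos rfl] at h
    linarith
  simp [sum_inner, h1]

/-- Derivatives of the coefficients multiply tangent vectors, which are orthogonal to `N`. What
remains is `√(det g)` times the mean curvature paired with `N`, which vanishes by minimality. -/
theorem inner_divergence_laplacianFlux_normal (hz : z ∈ (extChartAt (𝓡∂ k) x₀).target)
    {N : Ambient n} (hN : N ∈ normalSpace x₀ Φ z) :
    inner ℝ (∑ i, partialDeriv i (laplacianFlux g x₀ Φ i) z) N = 0 := by
  have hzH := target_subset_halfSpace hz
  have he0 : ∀ j, inner ℝ (partialDeriv j (inChart x₀ Φ) z) N = 0 := fun j ↦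
    (Submodule.mem_orthogonal _ _).1 hN _
      (Submodule.subset_span (mem_insert_of_mem _ (mem_range_self j)))
  have h1 : ∀ i, inner ℝ (partialDeriv i (laplacianFlux g x₀ Φ i) z) N =
      ∑ j, (volumeDensity g x₀ z * (gramMatrix g x₀ z)⁻¹ i j) *
        inner ℝ (secondFundamentalForm x₀ Φ i j z) N := fun i ↦ by
    have hd := fun j ↦ differentiableWithinAt_halfSpace (hΦ.contDiffOn_coefficient x₀ i j)
      (by simp) hz
    have he := fun i ↦ differentiableWithinAt_halfSpace
      (hΦ.contDiffOn_partialDeriv_inChart x₀ i) (by simp) hz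
    have h := partialDeriv_sum hzH Finset.univ (fun j _ ↦ (hd j).smul (he j)) i
    change partialDeriv i (laplacianFlux g x₀ Φ i) z = _ at h
    rw [h, sum_inner]
    refine Finset.sum_congr rfl fun j _ ↦ ?_
    refine (congrArg (inner ℝ · N) (partialDeriv_smul hzH (hd j) (he j) i)).trans ?_
    rw [inner_add_left, real_inner_smul_left,
      real_inner_smul_left, he0, mul_zero, zero_add, secondFundamentalForm,
      Submodule.inner_starProjection_left_eq_right, Submodule.starProjection_eq_self_iff.2 hN]
  rw [sum_inner, Finset.sum_congr rfl fun i _ ↦ h1 i]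
  have h2 := congrArg (fun v ↦ volumeDensity g x₀ z * inner ℝ v N) (hΦ.minimal x₀ z hz)
  simpa [meanCurvature, sum_inner, real_inner_smul_left, Finset.mul_sum, mul_assoc] using h2

/-- The position vector of a minimal immersion into the unit sphere satisfies
`Δ_g Φ = -k Φ`. -/
theorem divergence_laplacianFlux (hz : z ∈ (extChartAt (𝓡∂ k) x₀).target) :
    ∑ i, partialDeriv i (laplacianFlux g x₀ Φ i) z =
      -((k * volumeDensity g x₀ z) • inChart x₀ Φ z) := by
  -- The defect `V` is orthogonal to `Φ` and to all `∂ₗ Φ`, hence normal; it is also orthogonal to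
  -- every normal vector, hence to itself.
  set V := ∑ i, partialDeriv i (laplacianFlux g x₀ Φ i) z +
    (k * volumeDensity g x₀ z) • inChart x₀ Φ z with hV
  have hself : inner ℝ V (inChart x₀ Φ z) = 0 := by
    rw [hV, inner_add_left, hΦ.inner_divergence_laplacianFlux_self hz, real_inner_smul_left,
      real_inner_self_eq_norm_sq]
    simp [inChart, (hΦ.mem_cap _).1]
  have hN : V ∈ normalSpace x₀ Φ z := by
    rw [normalSpace, Submodule.mem_orthogonal']
    intro u hu
    induction hu using Submodule.span_induction with
    | mem u hu =>
      rcases hu with rfl | ⟨l, rfl⟩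
      · exact hself
      · simp only [hV, inner_add_left, hΦ.inner_divergence_laplacianFlux_partialDeriv hz,
          real_inner_smul_left, zero_add]
        rw [real_inner_comm, hΦ.inner_partialDeriv_self hz, mul_zero]
    | zero => simp
    | add a b _ _ ha hb => rw [inner_add_right, ha, hb, add_zero]
    | smul c a _ ha => rw [real_inner_smul_right, ha, mul_zero]
  have h0 : inner ℝ V V = 0 := by
    nth_rewrite 1 [hV]
    rw [inner_add_left, hΦ.inner_divergence_laplacianFlux_normal hz hN, real_inner_smul_left,
      real_inner_comm, hself, mul_zero, add_zero]
  exact eq_neg_of_add_eq_zero_left (inner_self_eq_zero.1 h0)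

theorem partialDeriv_coordinate (a : ℝ) (hz : z ∈ (extChartAt (𝓡∂ k) x₀).target)
    (i : Fin k) :
    partialDeriv i (inChart x₀ fun p ↦ Φ p 0 - a) z = partialDeriv i (inChart x₀ Φ) z 0 := by
  have hzH := target_subset_halfSpace hz
  have hd := differentiableWithinAt_halfSpace (contDiffOn_inChart hΦ.contMDiff x₀) (by simp) hz
  have h := partialDeriv_clm hzH (EuclideanSpace.proj (𝕜 := ℝ) (0 : Fin (n + 1))) hd i
  have h' := partialDeriv_sub hzH
    ((EuclideanSpace.proj (𝕜 := ℝ) (0 : Fin (n + 1))).differentiableAt.comp_differentiableWithinAt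
      z hd) (differentiableWithinAt_const a) i
  rw [partialDeriv_const, sub_zero] at h'
  exact h'.trans h

/-- The zeroth component of the vector equation. This divergence form, not yet divided by the
density, is the one integrated by parts later. -/
theorem sum_partialDeriv_coordinate (a : ℝ) (hz : z ∈ (extChartAt (𝓡∂ k) x₀).target) :
    ∑ i, partialDeriv i (fun y ↦ volumeDensity g x₀ y * ∑ j, (gramMatrix g x₀ y)⁻¹ i j *
      partialDeriv j (inChart x₀ fun p ↦ Φ p 0 - a) y) z =
      -(k * volumeDensity g x₀ z * inChart x₀ (fun p ↦ Φ p 0) z) := by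
  have hzH := target_subset_halfSpace hz
  have h1 : ∀ i, partialDeriv i (fun y ↦ volumeDensity g x₀ y * ∑ j, (gramMatrix g x₀ y)⁻¹ i j *
      partialDeriv j (inChart x₀ fun p ↦ Φ p 0 - a) y) z =
      partialDeriv i (laplacianFlux g x₀ Φ i) z 0 := fun i ↦ by
    have h := partialDeriv_clm hzH (EuclideanSpace.proj (𝕜 := ℝ) (0 : Fin (n + 1)))
      (differentiableWithinAt_halfSpace (hΦ.contDiffOn_laplacianFlux x₀ i) (by simp) hz) i
    refine (partialDeriv_congr (fun y hy ↦ ?_) hz i).trans h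
    simp only [hΦ.partialDeriv_coordinate a hy, laplacianFlux, map_sum, map_smul, Finset.mul_sum]
    exact Finset.sum_congr rfl fun j _ ↦ by simp [mul_assoc]
  rw [Finset.sum_congr rfl fun i _ ↦ h1 i]
  have h2 := congrArg (EuclideanSpace.proj (𝕜 := ℝ) (0 : Fin (n + 1)))
    (hΦ.divergence_laplacianFlux hz)
  simpa [inChart] using h2

theorem chartLaplacian_coordinate (a : ℝ) (hz : z ∈ (extChartAt (𝓡∂ k) x₀).target) :
    chartLaplacian g x₀ (fun p ↦ Φ p 0 - a) z = -(k * inChart x₀ (fun p ↦ Φ p 0) z) := by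
  have h0 := (volumeDensity_pos g hz).ne'
  rw [chartLaplacian, hΦ.sum_partialDeriv_coordinate a hz]
  field_simp

end IsFreeBoundaryMinimalImmersion

end MinimalImmersion

/-! ### Classical solutions: comparison with `Φ⁰ - a` -/

section MaximumPrinciple

/-- The second derivative test at a local maximum. -/
theorem fderiv_fderiv_nonpos_of_isLocalMax {E : Type*} [NormedAddCommGroup E] [NormedSpace ℝ E]
    {q : E → ℝ} {z : E} (hq : ContDiffAt ℝ 2 q z) (hmax : IsLocalMax q z) (b : E) :
    fderiv ℝ (fderiv ℝ q) z b b ≤ 0 := by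
  by_contra! hpos
  have hline : ∀ t : ℝ, HasDerivAt (fun s : ℝ ↦ z + s • b) b t := fun t ↦ by
    simpa using ((hasDerivAt_id t).smul_const b).const_add z
  have hcont : ContinuousAt (fun s : ℝ ↦ z + s • b) 0 := (hline 0).continuousAt
  have hz0 : z + (0 : ℝ) • b = z := by simp
  have htend : Filter.Tendsto (fun s : ℝ ↦ z + s • b) (nhds 0) (nhds z) := by
    simpa [ContinuousAt] using hcont
  have hd1 : ∀ᶠ t in nhds (0 : ℝ), HasDerivAt (fun s : ℝ ↦ q (z + s • b))
      (fderiv ℝ q (z + t • b) b) t := by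
    have h := htend.eventually (hq.eventually (by simp))
    filter_upwards [h] with t ht
    exact (ht.differentiableAt (by simp)).hasFDerivAt.comp_hasDerivAt t (hline t)
  have hderiv : deriv (fun s : ℝ ↦ q (z + s • b)) =ᶠ[nhds 0]
      fun t ↦ fderiv ℝ q (z + t • b) b := hd1.mono fun t ht ↦ ht.deriv
  have hd2 : HasDerivAt (fun t : ℝ ↦ fderiv ℝ q (z + t • b) b)
      (fderiv ℝ (fderiv ℝ q) z b b) 0 := by
    have h : DifferentiableAt ℝ (fderiv ℝ q) z :=
      (hq.fderiv_right (m := 1) (by norm_num)).differentiableAt (by simp)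
    have h' : HasFDerivAt (fderiv ℝ q) (fderiv ℝ (fderiv ℝ q) z) (z + (0 : ℝ) • b) := by
      rw [hz0]; exact h.hasFDerivAt
    have h2 := h'.comp_hasDerivAt (0 : ℝ) (hline 0)
    simpa using h2.clm_apply (hasDerivAt_const (0 : ℝ) b)
  have hmax' : IsLocalMax (fun s : ℝ ↦ q (z + s • b)) 0 := by
    have h := htend.eventually hmax
    filter_upwards [h] with t ht
    simpa using ht
  -- A positive second derivative would make the maximum also a local minimum, so the function would
  -- be constant along the line near `0` and its second derivative zero.
  have hmin : IsLocalMin (fun s : ℝ ↦ q (z + s • b)) 0 := by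
    refine isLocalMin_of_deriv_deriv_pos ?_ hmax'.deriv_eq_zero
      (hd1.self_of_nhds).continuousAt
    rw [hderiv.deriv_eq, hd2.deriv]
    exact hpos
  have hconst : (fun s : ℝ ↦ q (z + s • b)) =ᶠ[nhds 0] fun _ ↦ q (z + (0 : ℝ) • b) := by
    filter_upwards [hmax', hmin] with t h1 h2 using le_antisymm h1 h2
  have h0 : deriv (fun s : ℝ ↦ q (z + s • b)) =ᶠ[nhds 0] fun _ ↦ 0 :=
    hconst.deriv.trans (Filter.Eventually.of_forall fun t ↦ by simp)
  have := h0.deriv_eq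
  rw [hderiv.deriv_eq, hd2.deriv] at this
  simp at this
  linarith

variable {k n : ℕ} [NeZero k] {M : Type*} [TopologicalSpace M]
  [ChartedSpace (EuclideanHalfSpace k) M]

theorem partialDeriv_eq_fderiv {F : Type*} [NormedAddCommGroup F] [NormedSpace ℝ F]
    {z : EuclideanSpace ℝ (Fin k)} (hz : z ∈ interior (range (𝓡∂ k)))
    (f : EuclideanSpace ℝ (Fin k) → F) (i : Fin k) :
    partialDeriv i f z = fderiv ℝ f z (EuclideanSpace.single i 1) := by
  rw [partialDeriv, fderivWithin_of_mem_nhds (mem_interior_iff_mem_nhds.1 hz)]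

/-- Writing `A` as a sum of rank-one matrices `v vᵀ` turns the expression into a sum of second
derivatives along the vectors `v`. -/
theorem sum_mul_partialDeriv_partialDeriv_nonpos {q : EuclideanSpace ℝ (Fin k) → ℝ}
    {z : EuclideanSpace ℝ (Fin k)} (hz : z ∈ interior (range (𝓡∂ k)))
    (hq : ContDiffAt ℝ 2 q z) (hmax : IsLocalMax q z) {A : Matrix (Fin k) (Fin k) ℝ}
    (hA : A.PosSemidef) :
    ∑ i, ∑ j, A i j * partialDeriv i (partialDeriv j q) z ≤ 0 := by
  have h1 : ∀ i j, partialDeriv i (partialDeriv j q) z =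
      fderiv ℝ (fderiv ℝ q) z (EuclideanSpace.single i 1) (EuclideanSpace.single j 1) := by
    intro i j
    have hev : partialDeriv j q =ᶠ[nhds z]
        fun y ↦ fderiv ℝ q y (EuclideanSpace.single j 1) := by
      filter_upwards [isOpen_interior.mem_nhds hz] with y hy using partialDeriv_eq_fderiv hy q j
    have hd : DifferentiableAt ℝ (fderiv ℝ q) z :=
      (hq.fderiv_right (m := 1) (by norm_num)).differentiableAt (by simp)
    rw [partialDeriv_eq_fderiv hz, hev.fderiv_eq,
      fderiv_clm_apply hd (differentiableAt_const _)]
    simp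
  obtain ⟨m, v, rfl⟩ := Matrix.posSemidef_iff_eq_sum_vecMulVec.1 hA
  have h2 : ∑ i, ∑ j, (∑ l, Matrix.vecMulVec (v l) (star (v l))) i j *
      partialDeriv i (partialDeriv j q) z = ∑ l, fderiv ℝ (fderiv ℝ q) z
        (WithLp.toLp 2 (v l)) (WithLp.toLp 2 (v l)) := by
    have hv : ∀ l, (WithLp.toLp 2 (v l) : EuclideanSpace ℝ (Fin k)) =
        ∑ i, v l i • EuclideanSpace.single i (1 : ℝ) := fun l ↦ by
      ext j; simp [Finset.sum_apply, Pi.single_apply]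
    simp only [h1, hv, map_sum, map_smul, sum_apply, smul_apply, smul_eq_mul, Matrix.sum_apply,
      Matrix.vecMulVec_apply, Finset.sum_mul, Finset.mul_sum, star_trivial]
    rw [Finset.sum_congr rfl fun i _ ↦ Finset.sum_comm, Finset.sum_comm]
    refine Finset.sum_congr rfl fun l _ ↦ ?_
    rw [Finset.sum_comm]
    exact Finset.sum_congr rfl fun i _ ↦ Finset.sum_congr rfl fun j _ ↦ by ring
  rw [h2]
  exact Finset.sum_nonpos fun l _ ↦ fderiv_fderiv_nonpos_of_isLocalMax hq hmax _

variable [IsManifold (𝓡∂ k) ∞ M]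
  {x₀ : M} {z : EuclideanSpace ℝ (Fin k)} {g : Metric k M} {Φ : M → Ambient n} {r : ℝ}

theorem isManifold_two : IsManifold (𝓡∂ k) 2 M :=
  IsManifold.of_le (n := ∞) (WithTop.coe_le_coe.2 (le_top : (2 : ℕ∞) ≤ ⊤))

namespace IsFreeBoundaryMinimalImmersion

variable (hΦ : IsFreeBoundaryMinimalImmersion g r Φ)
include hΦ

theorem contDiffOn_flux {u : M → ℝ} {m m' : ℕ∞} (x₀ : M)
    (hu : ContDiffOn ℝ m (inChart x₀ u) (extChartAt (𝓡∂ k) x₀).target) (hm : m' + 1 ≤ m)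
    (i : Fin k) :
    ContDiffOn ℝ m' (fun y ↦ volumeDensity g x₀ y * ∑ j, (gramMatrix g x₀ y)⁻¹ i j *
      partialDeriv j (inChart x₀ u) y) (extChartAt (𝓡∂ k) x₀).target := by
  have hm' : (m' : ℕ∞ω) ≤ ∞ := WithTop.coe_le_coe.2 le_top
  refine ((hΦ.contDiffOn_volumeDensity x₀).of_le hm').mul (ContDiffOn.sum fun j _ ↦ ?_)
  exact ((hΦ.contDiffOn_inv_gramMatrix x₀ i j).of_le hm').mul
    (contDiffOn_partialDeriv hu (by exact_mod_cast hm) j)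

theorem chartLaplacian_sub_smul {u w : M → ℝ}
    (hu : ContDiffOn ℝ 2 (inChart x₀ u) (extChartAt (𝓡∂ k) x₀).target)
    (hw : ContDiffOn ℝ 2 (inChart x₀ w) (extChartAt (𝓡∂ k) x₀).target) (c : ℝ)
    (hz : z ∈ (extChartAt (𝓡∂ k) x₀).target) :
    chartLaplacian g x₀ (fun p ↦ u p - c * w p) z =
      chartLaplacian g x₀ u z - c * chartLaplacian g x₀ w z := by
  have hzH := target_subset_halfSpace hz
  have hfu := fun i ↦ differentiableWithinAt_halfSpace
    (hΦ.contDiffOn_flux (m := 2) (m' := 1) x₀ hu (by norm_num) i) (by simp) hz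
  have hfw := fun i ↦ differentiableWithinAt_halfSpace
    (hΦ.contDiffOn_flux (m := 2) (m' := 1) x₀ hw (by norm_num) i) (by simp) hz
  have hd : ∀ y ∈ (extChartAt (𝓡∂ k) x₀).target, ∀ j,
      partialDeriv j (inChart x₀ fun p ↦ u p - c * w p) y =
        partialDeriv j (inChart x₀ u) y - c * partialDeriv j (inChart x₀ w) y := by
    intro y hy j
    have hyH := target_subset_halfSpace hy
    have h1 := differentiableWithinAt_halfSpace hu (by simp) hy
    have h2 := differentiableWithinAt_halfSpace hw (by simp) hy
    exact partialDeriv_sub_const_mul hyH h1 h2 c j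
  simp only [chartLaplacian]
  have h : ∀ i, partialDeriv i (fun y ↦ volumeDensity g x₀ y * ∑ j, (gramMatrix g x₀ y)⁻¹ i j *
      partialDeriv j (inChart x₀ fun p ↦ u p - c * w p) y) z =
      partialDeriv i (fun y ↦ volumeDensity g x₀ y * ∑ j, (gramMatrix g x₀ y)⁻¹ i j *
        partialDeriv j (inChart x₀ u) y) z -
      c * partialDeriv i (fun y ↦ volumeDensity g x₀ y * ∑ j, (gramMatrix g x₀ y)⁻¹ i j *
        partialDeriv j (inChart x₀ w) y) z := fun i ↦ by
    refine (partialDeriv_congr (fun y hy ↦ ?_) hz i).trans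
      (partialDeriv_sub_const_mul hzH (hfu i) (hfw i) c i)
    simp only [hd y hy, mul_sub, Finset.sum_sub_distrib, Finset.mul_sum]
    congr 1
    exact Finset.sum_congr rfl fun j _ ↦ by ring
  rw [Finset.sum_congr rfl fun i _ ↦ h i, Finset.sum_sub_distrib, ← Finset.mul_sum]
  ring

/-- The gradient vanishes at the maximum, so only the principal part `∑ g^{ij} ∂ᵢ ∂ⱼ q` of the
Laplacian survives. -/
theorem chartLaplacian_nonpos_of_isLocalMax {q : M → ℝ}
    (hq : ContDiffOn ℝ 2 (inChart x₀ q) (extChartAt (𝓡∂ k) x₀).target)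
    (hz : z ∈ (extChartAt (𝓡∂ k) x₀).target) (hzi : z ∈ interior (range (𝓡∂ k)))
    (hmax : IsLocalMax (inChart x₀ q) z) : chartLaplacian g x₀ q z ≤ 0 := by
  have hzH := target_subset_halfSpace hz
  have hqz : ContDiffAt ℝ 2 (inChart x₀ q) z :=
    (contDiffWithinAt_halfSpace hq hz).contDiffAt (mem_interior_iff_mem_nhds.1 hzi)
  have hgrad : ∀ j, partialDeriv j (inChart x₀ q) z = 0 := fun j ↦ by
    rw [partialDeriv_eq_fderiv hzi, hmax.fderiv_eq_zero]; rfl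
  have hd := fun i ↦ differentiableWithinAt_halfSpace (contDiffOn_partialDeriv (m := 1) hq
    (by norm_num) i) (by simp) hz
  have hc := fun i j ↦ differentiableWithinAt_halfSpace (hΦ.contDiffOn_coefficient x₀ i j)
    (by simp) hz
  have h : ∀ i, partialDeriv i (fun y ↦ volumeDensity g x₀ y * ∑ j, (gramMatrix g x₀ y)⁻¹ i j *
      partialDeriv j (inChart x₀ q) y) z = volumeDensity g x₀ z *
        ∑ j, (gramMatrix g x₀ z)⁻¹ i j * partialDeriv i (partialDeriv j (inChart x₀ q)) z := by
    intro i
    simp only [Finset.mul_sum, ← mul_assoc]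
    refine (partialDeriv_sum hzH Finset.univ (fun j _ ↦ (hc i j).mul (hd j)) i).trans ?_
    refine Finset.sum_congr rfl fun j _ ↦ ?_
    refine (partialDeriv_mul hzH (hc i j) (hd j) i).trans ?_
    rw [hgrad, mul_zero, zero_add]
  rw [chartLaplacian, Finset.sum_congr rfl fun i _ ↦ h i, ← Finset.mul_sum, ← mul_assoc,
    inv_mul_cancel₀ (volumeDensity_pos g hz).ne', one_mul]
  exact sum_mul_partialDeriv_partialDeriv_nonpos hzi hqz hmax
    (posDef_gramMatrix g hz).inv.posSemidef

theorem continuous_coordinate : Continuous fun p ↦ Φ p 0 :=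
  (EuclideanSpace.proj (𝕜 := ℝ) (0 : Fin (n + 1))).continuous.comp hΦ.contMDiff.continuous

theorem le_one (p : M) : Φ p 0 ≤ 1 := by
  have h := PiLp.norm_apply_le (Φ p) 0
  rw [(hΦ.mem_cap p).1] at h
  exact (le_abs_self _).trans h

theorem contMDiff_coordinate (a : ℝ) : ContMDiff (𝓡∂ k) 𝓘(ℝ, ℝ) ∞ fun p ↦ Φ p 0 - a :=
  ((EuclideanSpace.proj (𝕜 := ℝ) (0 : Fin (n + 1))).contMDiff.comp hΦ.contMDiff).sub
    contMDiff_const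

theorem le_of_solvesDirichlet_of_pos [CompactSpace M] {a : ℝ} (ha : 0 < a)
    (ha' : a < Real.cos r) {α lam : ℝ} {w : M → ℝ} (hw : SolvesDirichlet g α lam w)
    {p₁ : M} (hp₁ : 0 < w p₁) : k * (1 + a) ≤ α + lam := by
  have : IsManifold (𝓡∂ k) 2 M := isManifold_two
  have hfpos : ∀ p, 0 < Φ p 0 - a := fun p ↦ by linarith [(hΦ.mem_cap p).2]
  have hf := hΦ.contMDiff_coordinate a
  obtain ⟨p, -, hp⟩ := isCompact_univ.exists_isMaxOn ⟨p₁, mem_univ p₁⟩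
    (hw.contMDiff.continuous.div
      (hΦ.continuous_coordinate.sub continuous_const) fun p ↦ (hfpos p).ne').continuousOn
  -- With this `m`, `w - m f ≤ 0` everywhere, with equality at `p`.
  set m := w p / (Φ p 0 - a) with hm
  have hmp : ∀ q, w q - m * (Φ q 0 - a) ≤ 0 := fun q ↦ by
    have h : w q / (Φ q 0 - a) ≤ m := hp (mem_univ q)
    linarith [(div_le_iff₀ (hfpos q)).1 h]
  have hm0 : 0 < m := by
    refine (div_pos hp₁ (hfpos p₁)).trans_le ?_
    exact hp (mem_univ p₁)
  have hwm : w p = m * (Φ p 0 - a) := by rw [hm, div_mul_cancel₀ _ (hfpos p).ne']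
  have hwp : w p ≠ 0 := by
    rw [hwm]; exact (mul_pos hm0 (hfpos p)).ne'
  -- As `w p = m f(p) > 0`, the Dirichlet condition keeps `p` off the boundary.
  have hint : (𝓡∂ k).IsInteriorPoint p := by
    rw [ModelWithCorners.isInteriorPoint_iff_not_isBoundaryPoint]
    exact fun hb ↦ hwp (hw.boundary p hb)
  set z := extChartAt (𝓡∂ k) p p with hz
  have hzt : z ∈ (extChartAt (𝓡∂ k) p).target := mem_extChartAt_target p
  have hzp : (extChartAt (𝓡∂ k) p).symm z = p := extChartAt_to_inv p
  have hwc : ContDiffOn ℝ 2 (inChart p w) (extChartAt (𝓡∂ k) p).target :=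
    contDiffOn_inChart hw.contMDiff p
  have hfc : ContDiffOn ℝ 2 (inChart p fun q ↦ Φ q 0 - a) (extChartAt (𝓡∂ k) p).target :=
    (contDiffOn_inChart hf p).of_le (WithTop.coe_le_coe.2 (le_top : (2 : ℕ∞) ≤ ⊤))
  have hmax : IsLocalMax (inChart p fun q ↦ w q - m * (Φ q 0 - a)) z := by
    refine Filter.Eventually.of_forall fun y ↦ ?_
    have h0 : inChart p (fun q ↦ w q - m * (Φ q 0 - a)) z = 0 := by
      simp only [inChart, hzp, hwm, sub_self]
    rw [h0]
    exact hmp _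
  have hL := hΦ.chartLaplacian_nonpos_of_isLocalMax
    (hwc.sub (contDiffOn_const.mul hfc)) hzt hint hmax
  rw [hΦ.chartLaplacian_sub_smul hwc hfc m hzt, hw.equation p z hzt,
    hΦ.chartLaplacian_coordinate a hzt] at hL
  simp only [inChart, hzp] at hL
  rw [hwm] at hL
  have h1 : m * (k * Φ p 0) ≤ m * ((α + lam) * (Φ p 0 - a)) := by linarith
  have h2 := le_of_mul_le_mul_left h1 hm0
  have h3 := hΦ.le_one p
  -- The supersolution inequality `(1 + a) f ≤ Φ⁰`; it amounts to `a Φ⁰ ≤ a + a²`, which holds since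
  -- `Φ⁰ ≤ 1`.
  have h5 : k * (1 + a) * (Φ p 0 - a) ≤ k * Φ p 0 := by
    rw [mul_assoc]
    refine mul_le_mul_of_nonneg_left ?_ (Nat.cast_nonneg k)
    nlinarith
  exact le_of_mul_le_mul_right (h5.trans h2) (hfpos p)

end IsFreeBoundaryMinimalImmersion

theorem SolvesDirichlet.neg {α lam : ℝ} {w : M → ℝ} (hw : SolvesDirichlet g α lam w) :
    SolvesDirichlet g α lam fun p ↦ -w p where
  contMDiff := hw.contMDiff.neg
  boundary p hp := by rw [hw.boundary p hp, neg_zero]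
  equation x₀ z hz := by
    have hd : ∀ y ∈ (extChartAt (𝓡∂ k) x₀).target, ∀ j,
        partialDeriv j (inChart x₀ fun p ↦ -w p) y = -partialDeriv j (inChart x₀ w) y :=
      fun y hy j ↦ partialDeriv_neg (target_subset_halfSpace hy) _ j
    have h : ∀ i, partialDeriv i (fun y ↦ volumeDensity g x₀ y *
        ∑ j, (gramMatrix g x₀ y)⁻¹ i j * partialDeriv j (inChart x₀ fun p ↦ -w p) y) z =
        -partialDeriv i (fun y ↦ volumeDensity g x₀ y * ∑ j, (gramMatrix g x₀ y)⁻¹ i j *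
          partialDeriv j (inChart x₀ w) y) z := fun i ↦ by
      rw [← partialDeriv_neg (target_subset_halfSpace hz)]
      refine partialDeriv_congr (fun y hy ↦ ?_) hz i
      simp only [hd y hy, mul_neg, Finset.sum_neg_distrib]
    have he := hw.equation x₀ z hz
    rw [chartLaplacian] at he ⊢
    rw [Finset.sum_congr rfl fun i _ ↦ h i, Finset.sum_neg_distrib, mul_neg, he]
    simp only [inChart]
    ring

/-- Either `w` or `-w` is positive somewhere. The case `α = k` excludes solutions with `lam ≤ 0`;
the case `α = 0` bounds the eigenvalues. -/
theorem IsFreeBoundaryMinimalImmersion.le_of_solvesDirichlet [CompactSpace M]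
    (hΦ : IsFreeBoundaryMinimalImmersion g r Φ) {a : ℝ} (ha : 0 < a)
    (ha' : a < Real.cos r) {α lam : ℝ} {w : M → ℝ} (hw : SolvesDirichlet g α lam w)
    (hne : w ≠ 0) : k * (1 + a) ≤ α + lam := by
  obtain ⟨p, hp⟩ := Function.ne_iff.1 hne
  rcases lt_or_gt_of_ne hp with h | h
  · exact hΦ.le_of_solvesDirichlet_of_pos ha ha' hw.neg (p₁ := p) (neg_pos.2 h)
  · exact hΦ.le_of_solvesDirichlet_of_pos ha ha' hw h

end MaximumPrinciple

/-! ### The Riemannian volume in charts -/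

section Volume

variable {k n : ℕ} [NeZero k] {M : Type*} [TopologicalSpace M]
  [ChartedSpace (EuclideanHalfSpace k) M]

theorem measurableSet_target (x₀ : M) : MeasurableSet (extChartAt (𝓡∂ k) x₀).target := by
  rw [extChartAt_target]
  exact (((chartAt _ x₀).open_target.preimage (𝓡∂ k).continuous_symm).measurableSet).inter
    (𝓡∂ k).isClosed_range.measurableSet

theorem measurableSet_target_inter_preimage [MeasurableSpace M] [BorelSpace M] (x₀ : M)
    {A : Set M} (hA : MeasurableSet A) :
    MeasurableSet ((extChartAt (𝓡∂ k) x₀).target ∩ (extChartAt (𝓡∂ k) x₀).symm ⁻¹' A) := by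
  have h := (continuousOn_iff_continuous_domRestrict.1
    (continuousOn_extChartAt_symm (I := 𝓡∂ k) x₀)).measurable hA
  have h2 := (measurableSet_target x₀).subtype_image h
  convert h2 using 1
  ext z
  simp [and_comm]

theorem aemeasurable_extChartAt_symm [MeasurableSpace M] [BorelSpace M] (x₀ : M) :
    AEMeasurable (extChartAt (𝓡∂ k) x₀).symm (volume.restrict (extChartAt (𝓡∂ k) x₀).target) :=
  (continuousOn_extChartAt_symm (I := 𝓡∂ k) x₀).aemeasurable (measurableSet_target x₀)

variable [IsManifold (𝓡∂ k) ∞ M] {x₀ : M} {z : EuclideanSpace ℝ (Fin k)} {g : Metric k M}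
  {Φ : M → Ambient n} {r : ℝ}

theorem chartVolume_apply [MeasurableSpace M] [BorelSpace M] (g : Metric k M) (x₀ : M)
    {A : Set M} (hA : MeasurableSet A) : chartVolume g x₀ A =
      ∫⁻ z in (extChartAt (𝓡∂ k) x₀).target ∩ (extChartAt (𝓡∂ k) x₀).symm ⁻¹' A,
        ENNReal.ofReal (volumeDensity g x₀ z) := by
  rw [chartVolume, Measure.map_apply_of_aemeasurable
    ((aemeasurable_extChartAt_symm x₀).mono_ac (withDensity_absolutelyContinuous _ _)) hA,
    withDensity_apply', Measure.restrict_restrict' (measurableSet_target x₀), inter_comm]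

theorem chartVolume_compl_source [MeasurableSpace M] [BorelSpace M] (g : Metric k M) (x₀ : M) :
    chartVolume g x₀ (extChartAt (𝓡∂ k) x₀).sourceᶜ = 0 := by
  rw [chartVolume_apply g x₀ (isOpen_extChartAt_source x₀).measurableSet.compl]
  have : (extChartAt (𝓡∂ k) x₀).target ∩
      (extChartAt (𝓡∂ k) x₀).symm ⁻¹' (extChartAt (𝓡∂ k) x₀).sourceᶜ = ∅ := by
    ext z
    simp only [mem_inter_iff, mem_preimage, mem_compl_iff, mem_empty_iff_false, iff_false]
    exact fun h ↦ h.2 ((extChartAt (𝓡∂ k) x₀).map_target h.1)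
  rw [this]
  simp

namespace IsFreeBoundaryMinimalImmersion

variable (hΦ : IsFreeBoundaryMinimalImmersion g r Φ)
include hΦ

/-- The transformation law of the volume density under a change of charts. -/
theorem abs_det_mul_volumeDensity {x₁ : M} (hz : z ∈ (extChartAt (𝓡∂ k) x₀).target)
    (hz' : (extChartAt (𝓡∂ k) x₀).symm z ∈ (extChartAt (𝓡∂ k) x₁).source) :
    |(fderivWithin ℝ (extChartAt (𝓡∂ k) x₁ ∘ (extChartAt (𝓡∂ k) x₀).symm)
      (range (𝓡∂ k)) z).det| *
        volumeDensity g x₁ (extChartAt (𝓡∂ k) x₁ ((extChartAt (𝓡∂ k) x₀).symm z)) =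
      volumeDensity g x₀ z := by
  have hzH := target_subset_halfSpace hz
  set τ := extChartAt (𝓡∂ k) x₁ ∘ (extChartAt (𝓡∂ k) x₀).symm with hτ
  set S := (extChartAt (𝓡∂ k) x₀).target ∩
    (extChartAt (𝓡∂ k) x₀).symm ⁻¹' (extChartAt (𝓡∂ k) x₁).source with hS
  have hSn : S ∈ nhdsWithin z (range (𝓡∂ k)) := by
    refine Filter.inter_mem (extChartAt_target_mem_nhdsWithin_of_mem hz) ?_
    have hc := (continuousOn_extChartAt_symm (I := 𝓡∂ k) x₀ z hz).mono_of_mem_nhdsWithin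
      (extChartAt_target_mem_nhdsWithin_of_mem hz)
    exact hc ((isOpen_extChartAt_source x₁).mem_nhds hz')
  have hSH : S ⊆ range (𝓡∂ k) := fun y hy ↦ target_subset_halfSpace hy.1
  have hτz : τ z ∈ (extChartAt (𝓡∂ k) x₁).target := (extChartAt (𝓡∂ k) x₁).map_source hz'
  have hmaps : MapsTo τ S (range (𝓡∂ k)) := fun y hy ↦
    target_subset_halfSpace ((extChartAt (𝓡∂ k) x₁).map_source hy.2)
  have hτd : HasFDerivWithinAt τ (fderivWithin ℝ τ (range (𝓡∂ k)) z) (range (𝓡∂ k)) z := by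
    have := contDiffWithinAt_ext_coord_change (I := 𝓡∂ k) (n := ∞) x₁ x₀ (y := z)
      ⟨hz, hz'⟩
    exact (this.differentiableWithinAt (by simp)).hasFDerivWithinAt
  have h1 := (differentiableWithinAt_halfSpace (contDiffOn_inChart hΦ.contMDiff x₁) (by simp)
    hτz).hasFDerivWithinAt
  have h2 := (h1.comp z (hτd.mono hSH) hmaps).mono_of_mem_nhdsWithin hSn
  -- Near `z`, `Φ` in the first chart is `Φ` in the second chart composed with the transition map
  -- `τ`; the chain rule then gives the congruence `Jᵀ G J` of Gram matrices.
  have h3 : HasFDerivWithinAt (inChart x₀ Φ) ((fderivWithin ℝ (inChart x₁ Φ) (range (𝓡∂ k))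
      (τ z)).comp (fderivWithin ℝ τ (range (𝓡∂ k)) z)) (range (𝓡∂ k)) z := by
    refine h2.congr_of_eventuallyEq ?_ ?_
    · filter_upwards [hSn] with y hy
      simp only [inChart, Function.comp_apply, hτ, (extChartAt (𝓡∂ k) x₁).left_inv hy.2]
    · simp only [inChart, Function.comp_apply, hτ, (extChartAt (𝓡∂ k) x₁).left_inv hz']
  set D := fderivWithin ℝ τ (range (𝓡∂ k)) z with hD
  have h4 : ∀ i, partialDeriv i (inChart x₀ Φ) z =
      ∑ l, D (EuclideanSpace.single i 1) l • partialDeriv l (inChart x₁ Φ) (τ z) := fun i ↦ by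
    simp only [partialDeriv, h3.fderivWithin (uniqueDiffWithinAt_halfSpace hzH)]
    have hv : D (EuclideanSpace.single i 1) =
        ∑ l, D (EuclideanSpace.single i 1) l • EuclideanSpace.single l (1 : ℝ) := by
      ext j; simp [Finset.sum_apply, Pi.single_apply]
    rw [ContinuousLinearMap.comp_apply]
    conv_lhs => rw [hv]
    simp only [map_sum, map_smul]
  set J : Matrix (Fin k) (Fin k) ℝ := Matrix.of fun l i ↦ D (EuclideanSpace.single i 1) l with hJ
  have hJdet : J.det = D.det := by
    rw [ContinuousLinearMap.det, ← LinearMap.det_toMatrix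
      (EuclideanSpace.basisFun (Fin k) ℝ).toBasis]
    congr 1
  have hgram : gramMatrix g x₀ z = J.transpose * gramMatrix g x₁ (τ z) * J := by
    ext i j
    rw [hΦ.gramMatrix_eq hz, h4, h4]
    simp only [sum_inner, inner_sum, real_inner_smul_left, real_inner_smul_right,
      ← hΦ.gramMatrix_eq hτz, Matrix.mul_apply, Matrix.transpose_apply, hJ, Matrix.of_apply,
      Finset.sum_mul]
    exact Finset.sum_congr rfl fun a _ ↦ Finset.sum_congr rfl fun b _ ↦ by ring
  have hdet : (gramMatrix g x₀ z).det = D.det ^ 2 * (gramMatrix g x₁ (τ z)).det := by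
    rw [hgram, Matrix.det_mul, Matrix.det_mul, Matrix.det_transpose, hJdet]
    ring
  change |D.det| * volumeDensity g x₁ (τ z) = _
  rw [volumeDensity, volumeDensity, hdet, Real.sqrt_mul (sq_nonneg _), Real.sqrt_sq_eq_abs]

variable [MeasurableSpace M] [BorelSpace M]

/-- Change of variables along the transition map, whose Jacobian is absorbed by the transformation
law of the density. -/
theorem chartVolume_eq_of_subset {x₁ : M} {A : Set M} (hA : MeasurableSet A)
    (h0 : A ⊆ (extChartAt (𝓡∂ k) x₀).source) (h1 : A ⊆ (extChartAt (𝓡∂ k) x₁).source) :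
    chartVolume g x₀ A = chartVolume g x₁ A := by
  set e₀ := extChartAt (𝓡∂ k) x₀
  set e₁ := extChartAt (𝓡∂ k) x₁
  have himg : (e₁ ∘ e₀.symm) '' (e₀.target ∩ e₀.symm ⁻¹' A) = e₁.target ∩ e₁.symm ⁻¹' A := by
    ext y
    constructor
    · rintro ⟨z, ⟨-, hzA⟩, rfl⟩
      refine ⟨e₁.map_source (h1 hzA), ?_⟩
      simpa [e₁.left_inv (h1 hzA)] using hzA
    · rintro ⟨hy, hyA⟩
      refine ⟨e₀ (e₁.symm y), ⟨e₀.map_source (h0 hyA), ?_⟩, ?_⟩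
      · simpa [e₀.left_inv (h0 hyA)] using hyA
      · simp [e₀.left_inv (h0 hyA), e₁.right_inv hy]
  have hinj : InjOn (e₁ ∘ e₀.symm) (e₀.target ∩ e₀.symm ⁻¹' A) := fun y hy z hz hyz ↦
    e₀.symm.injOn hy.1 hz.1 (e₁.injOn (h1 hy.2) (h1 hz.2) hyz)
  have hder : ∀ z ∈ e₀.target ∩ e₀.symm ⁻¹' A, HasFDerivWithinAt (e₁ ∘ e₀.symm)
      (fderivWithin ℝ (e₁ ∘ e₀.symm) (range (𝓡∂ k)) z) (e₀.target ∩ e₀.symm ⁻¹' A) z := by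
    intro z hz
    have := contDiffWithinAt_ext_coord_change (I := 𝓡∂ k) (n := ∞) x₁ x₀ (y := z)
      ⟨hz.1, h1 hz.2⟩
    exact (this.differentiableWithinAt (by simp)).hasFDerivWithinAt.mono
      fun y hy ↦ target_subset_halfSpace hy.1
  rw [chartVolume_apply g x₀ hA, chartVolume_apply g x₁ hA, ← himg,
    lintegral_image_eq_lintegral_abs_det_fderiv_mul volume
      (measurableSet_target_inter_preimage x₀ hA) hder hinj]
  refine setLIntegral_congr_fun (measurableSet_target_inter_preimage x₀ hA) fun z hz ↦ ?_
  rw [← ENNReal.ofReal_mul (abs_nonneg _), Function.comp_apply,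
    hΦ.abs_det_mul_volumeDensity hz.1 (h1 hz.2)]

/-- Other charts add nothing inside this chart domain, because the chart volumes agree on overlaps.
-/
theorem restrict_riemannianVolume (x₀ : M) :
    (riemannianVolume g).restrict (extChartAt (𝓡∂ k) x₀).source = chartVolume g x₀ := by
  set s := (extChartAt (𝓡∂ k) x₀).source with hs
  have hsm : MeasurableSet s := (isOpen_extChartAt_source x₀).measurableSet
  have hself : (chartVolume g x₀).restrict s = chartVolume g x₀ :=
    Measure.restrict_eq_self_of_ae_mem (chartVolume_compl_source g x₀)
  have hle : ∀ x₁, (chartVolume g x₁).restrict s ≤ chartVolume g x₀ := fun x₁ ↦ by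
    refine Measure.le_iff.2 fun A hA ↦ ?_
    set s₁ := (extChartAt (𝓡∂ k) x₁).source with hs₁
    have hs₁m : MeasurableSet s₁ := (isOpen_extChartAt_source x₁).measurableSet
    have hself₁ : (chartVolume g x₁).restrict s₁ = chartVolume g x₁ :=
      Measure.restrict_eq_self_of_ae_mem (chartVolume_compl_source g x₁)
    rw [Measure.restrict_apply hA, ← hself₁, Measure.restrict_apply (hA.inter hsm),
      hΦ.chartVolume_eq_of_subset (x₀ := x₁) (x₁ := x₀) ((hA.inter hsm).inter hs₁m)
        inter_subset_right (inter_subset_left.trans inter_subset_right)]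
    exact measure_mono (inter_subset_left.trans inter_subset_left)
  -- The supremum is controlled by a measure that dominates every chart volume and reduces to
  -- `chartVolume g x₀` on `s`.
  have hub : riemannianVolume g ≤
      chartVolume g x₀ + (riemannianVolume g).restrict sᶜ := by
    refine iSup_le fun x₁ ↦ ?_
    rw [← Measure.restrict_add_restrict_compl (μ := chartVolume g x₁) hsm]
    exact add_le_add (hle x₁) (Measure.restrict_mono le_rfl (le_iSup (chartVolume g) x₁))
  refine le_antisymm ?_ ?_
  · refine (Measure.restrict_mono le_rfl hub).trans ?_
    rw [Measure.restrict_add, hself, Measure.restrict_restrict hsm, inter_compl_self,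
      Measure.restrict_empty, add_zero]
  · rw [← hself]
    exact Measure.restrict_mono le_rfl (le_iSup (chartVolume g) x₀)

theorem integral_riemannianVolume {F : M → ℝ} (hFc : Continuous F)
    (hF : ∀ p ∉ (extChartAt (𝓡∂ k) x₀).source, F p = 0) :
    ∫ p, F p ∂riemannianVolume g =
      ∫ z in (extChartAt (𝓡∂ k) x₀).target, volumeDensity g x₀ z * inChart x₀ F z := by
  rw [← setIntegral_eq_integral_of_forall_compl_eq_zero hF, hΦ.restrict_riemannianVolume x₀,
    chartVolume, integral_map
      ((aemeasurable_extChartAt_symm x₀).mono_ac (withDensity_absolutelyContinuous _ _))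
      hFc.aestronglyMeasurable,
    integral_withDensity_eq_integral_toReal_smul₀
      (((hΦ.contDiffOn_volumeDensity x₀).continuousOn.aemeasurable
        (measurableSet_target x₀)).ennreal_ofReal) (by simp)]
  refine setIntegral_congr_fun (measurableSet_target x₀) fun z hz ↦ ?_
  rw [smul_eq_mul, ENNReal.toReal_ofReal (volumeDensity_pos g hz).le, inChart]

/-- Each point has a neighbourhood with bounded coordinates and bounded density, hence of finite
volume; compactness does the rest. -/
theorem isFiniteMeasure_riemannianVolume [CompactSpace M] :
    IsFiniteMeasure (riemannianVolume g) := by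
  have : IsLocallyFiniteMeasure (riemannianVolume g) := by
    refine ⟨fun p ↦ ?_⟩
    set z := extChartAt (𝓡∂ k) p p with hz
    have hzt : z ∈ (extChartAt (𝓡∂ k) p).target := mem_extChartAt_target p
    have hw : ContinuousWithinAt (volumeDensity g p) (range (𝓡∂ k)) z :=
      (contDiffWithinAt_halfSpace (hΦ.contDiffOn_volumeDensity p) hzt).continuousWithinAt
    have hN : Metric.ball z 1 ∩ {y | volumeDensity g p y < volumeDensity g p z + 1} ∈
        nhdsWithin z (range (𝓡∂ k)) :=
      Filter.inter_mem (mem_nhdsWithin_of_mem_nhds (Metric.ball_mem_nhds z one_pos))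
        (hw (Iio_mem_nhds (lt_add_one _)))
    have htend : Filter.Tendsto (extChartAt (𝓡∂ k) p) (nhds p) (nhdsWithin z (range (𝓡∂ k))) := by
      refine tendsto_nhdsWithin_iff.2 ⟨(continuousAt_extChartAt p), ?_⟩
      filter_upwards [extChartAt_source_mem_nhds (I := 𝓡∂ k) p] with q hq
      exact target_subset_halfSpace ((extChartAt (𝓡∂ k) p).map_source hq)
    obtain ⟨V, hVU, hVo, hpV⟩ := mem_nhds_iff.1
      (Filter.inter_mem (extChartAt_source_mem_nhds (I := 𝓡∂ k) p) (htend hN))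
    refine ⟨V, hVo.mem_nhds hpV, ?_⟩
    have hVm := hVo.measurableSet
    have h1 : riemannianVolume g V = chartVolume g p V := by
      rw [← hΦ.restrict_riemannianVolume p, Measure.restrict_apply hVm,
        inter_eq_left.2 fun q hq ↦ (hVU hq).1]
    rw [h1, chartVolume_apply g p hVm]
    have hsub : ∀ y ∈ (extChartAt (𝓡∂ k) p).target ∩ (extChartAt (𝓡∂ k) p).symm ⁻¹' V,
        y ∈ Metric.ball z 1 ∧ volumeDensity g p y < volumeDensity g p z + 1 := fun y hy ↦ by
      have := (hVU hy.2).2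
      rwa [mem_preimage, (extChartAt (𝓡∂ k) p).right_inv hy.1] at this
    calc ∫⁻ y in (extChartAt (𝓡∂ k) p).target ∩ (extChartAt (𝓡∂ k) p).symm ⁻¹' V,
          ENNReal.ofReal (volumeDensity g p y)
        ≤ ∫⁻ _ in (extChartAt (𝓡∂ k) p).target ∩ (extChartAt (𝓡∂ k) p).symm ⁻¹' V,
          ENNReal.ofReal (volumeDensity g p z + 1) :=
          setLIntegral_mono' (measurableSet_target_inter_preimage p hVm)
            fun y hy ↦ ENNReal.ofReal_le_ofReal (hsub y hy).2.le
      _ = ENNReal.ofReal (volumeDensity g p z + 1) *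
          volume ((extChartAt (𝓡∂ k) p).target ∩ (extChartAt (𝓡∂ k) p).symm ⁻¹' V) :=
          setLIntegral_const _ _
      _ < ⊤ := ENNReal.mul_lt_top ENNReal.ofReal_lt_top
          ((measure_mono fun y hy ↦ (hsub y hy).1).trans_lt measure_ball_lt_top)
  infer_instance

end IsFreeBoundaryMinimalImmersion

end Volume

/-! ### The divergence theorem on the half space -/

section HalfSpaceDivergence

variable {k : ℕ} [NeZero k]

theorem mem_range_halfSpace {z : EuclideanSpace ℝ (Fin k)} : z ∈ range (𝓡∂ k) ↔ 0 ≤ z 0 := by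
  rw [range_modelWithCornersEuclideanHalfSpace]; rfl

/-- The nearest-point projection onto the half space. -/
def halfSpaceProj (z : EuclideanSpace ℝ (Fin k)) : EuclideanSpace ℝ (Fin k) :=
  WithLp.toLp 2 (Function.update z 0 (max (z 0) 0))

theorem halfSpaceProj_zero (z : EuclideanSpace ℝ (Fin k)) :
    halfSpaceProj z 0 = max (z 0) 0 := by
  simp [halfSpaceProj]

theorem halfSpaceProj_mem (z : EuclideanSpace ℝ (Fin k)) : halfSpaceProj z ∈ range (𝓡∂ k) := by
  rw [mem_range_halfSpace, halfSpaceProj_zero]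
  exact le_max_right _ _

theorem halfSpaceProj_of_mem {z : EuclideanSpace ℝ (Fin k)} (hz : z ∈ range (𝓡∂ k)) :
    halfSpaceProj z = z := by
  rw [mem_range_halfSpace] at hz
  simp [halfSpaceProj, max_eq_left hz]

theorem lipschitzWith_halfSpaceProj :
    LipschitzWith 1 (halfSpaceProj : EuclideanSpace ℝ (Fin k) → EuclideanSpace ℝ (Fin k)) := by
  refine LipschitzWith.of_dist_le_mul fun x y ↦ ?_
  rw [NNReal.coe_one, one_mul, EuclideanSpace.dist_eq, EuclideanSpace.dist_eq]
  refine Real.sqrt_le_sqrt (Finset.sum_le_sum fun i _ ↦ ?_)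
  refine pow_le_pow_left₀ dist_nonneg ?_ 2
  by_cases hi : i = 0
  · subst hi
    rw [halfSpaceProj_zero, halfSpaceProj_zero, Real.dist_eq, Real.dist_eq]
    exact abs_max_sub_max_le_abs _ _ _
  · simp [halfSpaceProj, hi]

variable {V : EuclideanSpace ℝ (Fin k) → ℝ}

theorem continuousOn_partialDeriv_halfSpace (hV : ContDiffOn ℝ 1 V (range (𝓡∂ k))) (i : Fin k) :
    ContinuousOn (partialDeriv i V) (range (𝓡∂ k)) :=
  (hV.continuousOn_fderivWithin (𝓡∂ k).uniqueDiffOn le_rfl).clm_apply continuousOn_const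

theorem partialDeriv_eq_zero_of_notMem_tsupport {z : EuclideanSpace ℝ (Fin k)}
    (hz : z ∈ range (𝓡∂ k)) (hzV : z ∉ tsupport V) (i : Fin k) : partialDeriv i V z = 0 := by
  have h : V =ᶠ[nhdsWithin z (range (𝓡∂ k))] fun _ ↦ 0 :=
    (notMem_tsupport_iff_eventuallyEq.1 hzV).filter_mono nhdsWithin_le_nhds
  rw [partialDeriv, h.fderivWithin_eq (h.self_of_nhdsWithin hz)]
  simp

theorem integrableOn_partialDeriv_halfSpace (hV : ContDiffOn ℝ 1 V (range (𝓡∂ k)))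
    (hc : HasCompactSupport V) (i : Fin k) :
    IntegrableOn (partialDeriv i V) (range (𝓡∂ k)) := by
  have hK : IsCompact (tsupport V ∩ range (𝓡∂ k)) :=
    hc.isCompact.inter_right (𝓡∂ k).isClosed_range
  refine IntegrableOn.of_forall_sdiff_eq_zero (((continuousOn_partialDeriv_halfSpace hV i).mono
    inter_subset_right).integrableOn_compact hK) (𝓡∂ k).isClosed_range.measurableSet
    fun z hz ↦ ?_
  exact partialDeriv_eq_zero_of_notMem_tsupport hz.1 (fun h ↦ hz.2 ⟨h, hz.1⟩) i

/-- The integral over the half space of a partial derivative of a compactly supported `C¹`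
function that vanishes on the boundary is zero. -/
theorem integral_partialDeriv_eq_zero (hV : ContDiffOn ℝ 1 V (range (𝓡∂ k)))
    (hc : HasCompactSupport V) (h0 : ∀ z : EuclideanSpace ℝ (Fin k), z 0 = 0 → V z = 0)
    (i : Fin k) : ∫ z in range (𝓡∂ k), partialDeriv i V z = 0 := by
  have hK : IsCompact (tsupport V ∩ range (𝓡∂ k)) :=
    hc.isCompact.inter_right (𝓡∂ k).isClosed_range
  have hcont := hV.continuousOn_fderivWithin (𝓡∂ k).uniqueDiffOn le_rfl
  obtain ⟨C, hC⟩ := hK.exists_bound_of_continuousOn (hcont.mono inter_subset_right)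
  have hbound : ∀ z ∈ range (𝓡∂ k), ‖fderivWithin ℝ V (range (𝓡∂ k)) z‖₊ ≤ C.toNNReal := by
    intro z hz
    rw [← NNReal.coe_le_coe, coe_nnnorm]
    by_cases hzV : z ∈ tsupport V
    · exact (hC z ⟨hzV, hz⟩).trans (Real.le_coe_toNNReal C)
    · have h : V =ᶠ[nhdsWithin z (range (𝓡∂ k))] fun _ ↦ 0 :=
        (notMem_tsupport_iff_eventuallyEq.1 hzV).filter_mono nhdsWithin_le_nhds
      rw [h.fderivWithin_eq (h.self_of_nhdsWithin hz)]
      simp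
  have hconv : Convex ℝ (range (𝓡∂ k)) := by
    rw [range_modelWithCornersEuclideanHalfSpace]
    exact EuclideanHalfSpace.convex
  have hlipOn : LipschitzOnWith C.toNNReal V (range (𝓡∂ k)) :=
    hconv.lipschitzOnWith_of_nnnorm_fderivWithin_le (hV.differentiableOn (by simp)) hbound
  -- Since `V` vanishes on the boundary hyperplane, `G` is its extension by zero. It need not be
  -- `C¹` across the hyperplane, but it is Lipschitz with compact support.
  set G := V ∘ halfSpaceProj with hG
  have hGlip : LipschitzWith (C.toNNReal * 1) G := by
    rw [← lipschitzOnWith_univ]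
    exact hlipOn.comp lipschitzWith_halfSpaceProj.lipschitzOnWith
      fun z _ ↦ halfSpaceProj_mem z
  have hGpos : ∀ z ∈ range (𝓡∂ k), G z = V z := fun z hz ↦ by
    rw [hG, Function.comp_apply, halfSpaceProj_of_mem hz]
  have hGneg : ∀ z : EuclideanSpace ℝ (Fin k), z 0 ≤ 0 → G z = 0 := fun z hz ↦
    h0 _ (by rw [halfSpaceProj_zero, max_eq_right hz])
  have hGc : HasCompactSupport G := by
    refine HasCompactSupport.intro hc.isCompact fun z hz ↦ ?_
    rcases le_total (z 0) 0 with h | h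
    · exact hGneg z h
    · rw [hGpos z (mem_range_halfSpace.2 h)]
      exact image_eq_zero_of_notMem_tsupport hz
  -- Integration by parts against the constant `1` shows that the line derivative of `G` has zero
  -- integral; the direction `-eᵢ` offsets the sign in the formula.
  have hint := (LipschitzWith.const (1 : ℝ)).integral_lineDeriv_mul_eq (μ := volume) hGlip hGc
    (-EuclideanSpace.single i 1)
  have hld : ∀ (c : ℝ) (x v : EuclideanSpace ℝ (Fin k)), lineDeriv ℝ (fun _ ↦ c) x v = 0 :=
    fun c x v ↦ by simp [lineDeriv]
  simp only [hld, zero_mul, integral_zero, neg_neg, mul_one] at hint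
  rw [← integral_indicator (𝓡∂ k).isClosed_range.measurableSet]
  refine (integral_congr_ae ?_).trans hint.symm
  -- The boundary hyperplane is a null set; off it, the line derivative of `G` is `∂ᵢ V` inside and
  -- `0` outside.
  have hae : ∀ᵐ z : EuclideanSpace ℝ (Fin k), z ∉ frontier (range (𝓡∂ k)) :=
    measure_eq_zero_iff_ae_notMem.1 (hconv.addHaar_frontier volume)
  filter_upwards [hae] with z hz
  by_cases hzH : z ∈ range (𝓡∂ k)
  · have hzi : z ∈ interior (range (𝓡∂ k)) := by
      by_contra h
      exact hz ⟨subset_closure hzH, h⟩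
    have hev : G =ᶠ[nhds z] V := by
      filter_upwards [mem_interior_iff_mem_nhds.1 hzi] with y hy using hGpos y hy
    have hd : DifferentiableAt ℝ V z :=
      (hV.contDiffAt (mem_interior_iff_mem_nhds.1 hzi)).differentiableAt (by simp)
    rw [indicator_of_mem hzH, partialDeriv_eq_fderiv hzi, hev.lineDeriv_eq,
      hd.lineDeriv_eq_fderiv]
  · have hev : G =ᶠ[nhds z] fun _ ↦ 0 := by
      filter_upwards [(𝓡∂ k).isClosed_range.isOpen_compl.mem_nhds hzH] with y hy
      refine hGneg y ?_
      by_contra! h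
      exact hy (mem_range_halfSpace.2 h.le)
    rw [indicator_of_notMem hzH, hev.lineDeriv_eq, hld]

end HalfSpaceDivergence

/-! ### The weak equation and Barta's inequality -/

section WeakFormulation

variable {k n : ℕ} [NeZero k] {M : Type*} [TopologicalSpace M]
  [ChartedSpace (EuclideanHalfSpace k) M] [IsManifold (𝓡∂ k) ∞ M]
  {x₀ : M} {z : EuclideanSpace ℝ (Fin k)} {g : Metric k M} {Φ : M → Ambient n} {r : ℝ}

/-- Boundary points are defined through the preferred chart at the point itself; invariance of the
interior under change of charts allows any chart. -/
theorem extChartAt_symm_mem_boundary (hz : z ∈ (extChartAt (𝓡∂ k) x₀).target) (h0 : z 0 = 0) :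
    (extChartAt (𝓡∂ k) x₀).symm z ∈ (𝓡∂ k).boundary M := by
  rw [← ModelWithCorners.compl_interior]
  intro hint
  have hsrc : (extChartAt (𝓡∂ k) x₀).symm z ∈ (chartAt (EuclideanHalfSpace k) x₀).source := by
    have := (extChartAt (𝓡∂ k) x₀).map_target hz
    rwa [extChartAt_source] at this
  have h := (ModelWithCorners.isInteriorPoint_iff_of_mem_atlas (I := 𝓡∂ k) (n := ∞) (by simp)
    (chart_mem_atlas _ x₀) hsrc).1 hint
  change extChartAt (𝓡∂ k) x₀ ((extChartAt (𝓡∂ k) x₀).symm z) ∈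
    interior (extChartAt (𝓡∂ k) x₀).target at h
  rw [(extChartAt (𝓡∂ k) x₀).right_inv hz] at h
  have h' := interior_mono (extChartAt_target_subset_range x₀) h
  rw [interior_range_modelWithCornersEuclideanHalfSpace] at h'
  exact (h' : 0 < z 0).ne' h0

omit [IsManifold (𝓡∂ k) ∞ M] in
theorem differential_eq_zero_of_notMem_tsupport {u : M → ℝ} {p : M} (hp : p ∉ tsupport u) :
    differential (k := k) u p = 0 := by
  have h : u =ᶠ[nhds p] fun _ ↦ 0 := notMem_tsupport_iff_eventuallyEq.1 hp
  rw [differential, h.mfderiv_eq]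
  exact mfderiv_const

namespace IsFreeBoundaryMinimalImmersion

variable (hΦ : IsFreeBoundaryMinimalImmersion g r Φ)
include hΦ

theorem continuous_inner_gradient {u w : M → ℝ} (hu : ContMDiff (𝓡∂ k) 𝓘(ℝ, ℝ) ∞ u)
    (hw : ContMDiff (𝓡∂ k) 𝓘(ℝ, ℝ) ∞ w) :
    Continuous fun p ↦ g.inner p (gradient g u p) (gradient g w p) := by
  refine continuous_iff_continuousAt.2 fun p ↦ ?_
  have hc : ContinuousOn (fun z ↦ ∑ i, (∑ j, (gramMatrix g p z)⁻¹ i j *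
      partialDeriv j (inChart p u) z) * partialDeriv i (inChart p w) z)
      (extChartAt (𝓡∂ k) p).target := by
    have hd : ∀ {v : M → ℝ}, ContMDiff (𝓡∂ k) 𝓘(ℝ, ℝ) ∞ v → ∀ i,
        ContinuousOn (partialDeriv i (inChart p v)) (extChartAt (𝓡∂ k) p).target :=
      fun hv i ↦
        (contDiffOn_partialDeriv (m := ∞) (contDiffOn_inChart hv p) (by simp) i).continuousOn
    exact continuousOn_finsetSum _ fun i _ ↦ (continuousOn_finsetSum _ fun j _ ↦
      (hΦ.contDiffOn_inv_gramMatrix p i j).continuousOn.mul (hd hu j)).mul (hd hw i)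
  have hcomp := hc.comp (continuousOn_extChartAt (I := 𝓡∂ k) p) (extChartAt (𝓡∂ k) p).mapsTo
  refine (hcomp.continuousAt (extChartAt_source_mem_nhds p)).congr ?_
  filter_upwards [extChartAt_source_mem_nhds (I := 𝓡∂ k) p] with q hq
  have h := inner_gradient_gradient (x₀ := p) g (hu.mdifferentiable (by simp) _)
    (hw.mdifferentiable (by simp) _) ((extChartAt (𝓡∂ k) p).map_source hq)
  rw [(extChartAt (𝓡∂ k) p).left_inv hq] at h
  exact h.symm

theorem continuous_mul_coordinate_mul {ψ : M → ℝ} (hψ : Continuous ψ) :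
    Continuous fun p ↦ k * Φ p 0 * ψ p :=
  (continuous_const.mul hΦ.continuous_coordinate).mul hψ

variable [MeasurableSpace M] [BorelSpace M]

/-- The weak form of `-Δ_g (Φ⁰ - a) = k Φ⁰`, for test functions supported in a chart domain. -/
theorem integral_inner_gradient_of_tsupport_subset [CompactSpace M] (a : ℝ) {ψ : M → ℝ}
    (hψ : ContMDiff (𝓡∂ k) 𝓘(ℝ, ℝ) ∞ ψ)
    (hsupp : tsupport ψ ⊆ (chartAt (EuclideanHalfSpace k) x₀).source)
    (hbd : ∀ p ∈ (𝓡∂ k).boundary M, ψ p = 0) :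
    ∫ p, (g.inner p (gradient g (fun q ↦ Φ q 0 - a) p) (gradient g ψ p) - k * Φ p 0 * ψ p)
      ∂riemannianVolume g = 0 := by
  rw [← extChartAt_source (𝓡∂ k)] at hsupp
  set e := extChartAt (𝓡∂ k) x₀ with he
  have hf := hΦ.contMDiff_coordinate a
  have hψc : ContDiffOn ℝ ∞ (inChart x₀ ψ) e.target := contDiffOn_inChart hψ x₀
  have hone : (1 : ℕ∞ω) ≤ ∞ := WithTop.coe_le_coe.2 (le_top : (1 : ℕ∞) ≤ ⊤)
  set W : Fin k → EuclideanSpace ℝ (Fin k) → ℝ := fun i y ↦ volumeDensity g x₀ y *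
    ∑ j, (gramMatrix g x₀ y)⁻¹ i j * partialDeriv j (inChart x₀ fun p ↦ Φ p 0 - a) y with hW
  have hWc : ∀ i, ContDiffOn ℝ 1 (W i) e.target := fun i ↦
    hΦ.contDiffOn_flux (m := 2) (m' := 1) x₀ ((contDiffOn_inChart hf x₀).of_le
      (WithTop.coe_le_coe.2 (le_top : (2 : ℕ∞) ≤ ⊤))) (by norm_num) i
  set K := e '' tsupport ψ with hK
  have hKc : IsCompact K := ((isClosed_tsupport ψ).isCompact).image_of_continuousOn
    ((continuousOn_extChartAt x₀).mono hsupp)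
  have hKT : K ⊆ e.target := by
    rintro _ ⟨p, hp, rfl⟩
    exact e.map_source (hsupp hp)
  have hψ0 : ∀ y ∈ e.target, y ∉ K → inChart x₀ ψ y = 0 := fun y hy hyK ↦ by
    refine image_eq_zero_of_notMem_tsupport (f := ψ) fun h ↦ hyK ?_
    exact ⟨_, h, e.right_inv hy⟩
  -- The field `ψ Wⁱ` extended by zero stays `C¹` on the half space because the support of `ψ` has
  -- compact image `K` inside the chart target.
  set V : Fin k → EuclideanSpace ℝ (Fin k) → ℝ := fun i ↦
    e.target.indicator fun y ↦ inChart x₀ ψ y * W i y with hV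
  have hVT : ∀ i, ∀ y ∈ e.target, V i y = inChart x₀ ψ y * W i y := fun i y hy ↦
    indicator_of_mem hy _
  have hV0 : ∀ i, ∀ y ∉ K, V i y = 0 := fun i y hyK ↦ by
    by_cases hy : y ∈ e.target
    · rw [hVT i y hy, hψ0 y hy hyK, zero_mul]
    · exact indicator_of_notMem hy _
  have hVsupp : ∀ i, tsupport (V i) ⊆ K := fun i ↦
    closure_minimal (fun y hy ↦ by_contra fun h ↦ hy (hV0 i y h)) hKc.isClosed
  have hVc : ∀ i, HasCompactSupport (V i) := fun i ↦ HasCompactSupport.intro hKc (hV0 i)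
  have hVd : ∀ i, ContDiffOn ℝ 1 (V i) (range (𝓡∂ k)) := fun i y hy ↦ by
    by_cases hyT : y ∈ e.target
    · have h := contDiffWithinAt_halfSpace ((hψc.of_le hone).mul (hWc i)) hyT
      refine h.congr_of_eventuallyEq ?_ (hVT i y hyT)
      filter_upwards [extChartAt_target_mem_nhdsWithin_of_mem hyT] with x hx using hVT i x hx
    · have h : V i =ᶠ[nhds y] fun _ ↦ 0 := by
        filter_upwards [hKc.isClosed.isOpen_compl.mem_nhds fun h ↦ hyT (hKT h)] with x hx
          using hV0 i x hx
      exact (contDiffAt_const.congr_of_eventuallyEq h).contDiffWithinAt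
  have hVb : ∀ i, ∀ y : EuclideanSpace ℝ (Fin k), y 0 = 0 → V i y = 0 := fun i y hy ↦ by
    by_cases hyT : y ∈ e.target
    · rw [hVT i y hyT, inChart, hbd _ (extChartAt_symm_mem_boundary hyT hy), zero_mul]
    · exact indicator_of_notMem hyT _
  have hsum : ∫ y in range (𝓡∂ k), ∑ i, partialDeriv i (V i) y = 0 := by
    rw [integral_finsetSum _ fun i _ ↦ integrableOn_partialDeriv_halfSpace (hVd i) (hVc i) i]
    exact Finset.sum_eq_zero fun i _ ↦ integral_partialDeriv_eq_zero (hVd i) (hVc i) (hVb i) i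
  rw [setIntegral_eq_of_subset_of_forall_sdiff_eq_zero
    (𝓡∂ k).isClosed_range.measurableSet (extChartAt_target_subset_range x₀)
    fun y hy ↦ Finset.sum_eq_zero fun i _ ↦ partialDeriv_eq_zero_of_notMem_tsupport hy.1
      (fun h ↦ hy.2 (hKT (hVsupp i h))) i] at hsum
  rw [hΦ.integral_riemannianVolume (x₀ := x₀), ← hsum]
  · refine setIntegral_congr_fun (measurableSet_target x₀) fun y hy ↦ ?_
    have hyH := target_subset_halfSpace hy
    have hDV : ∀ i, partialDeriv i (V i) y =
        partialDeriv i (inChart x₀ ψ) y * W i y + inChart x₀ ψ y * partialDeriv i (W i) y :=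
      fun i ↦ (partialDeriv_congr (hVT i) hy i).trans
        (partialDeriv_mul hyH (differentiableWithinAt_halfSpace hψc (by simp) hy)
          (differentiableWithinAt_halfSpace (hWc i) (by simp) hy) i)
    simp only
    -- In `∑ ∂ᵢ(ψ Wⁱ)`, the terms with `∂ᵢ ψ` form `√(det g) ⟨∇f, ∇ψ⟩` and the others form `-√(det
    -- g) k Φ⁰ ψ`.
    rw [Finset.sum_congr rfl fun i _ ↦ hDV i, Finset.sum_add_distrib, ← Finset.mul_sum,
      hΦ.sum_partialDeriv_coordinate a hy]
    have hgr := inner_gradient_gradient (x₀ := x₀) g (hf.mdifferentiable (by simp) _)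
      (hψ.mdifferentiable (by simp) _) hy
    simp only [inChart] at hgr ⊢
    have h1 : ∀ i, partialDeriv i (inChart x₀ ψ) y * W i y =
        volumeDensity g x₀ y * ((∑ j, (gramMatrix g x₀ y)⁻¹ i j *
          partialDeriv j (inChart x₀ fun p ↦ Φ p 0 - a) y) *
          partialDeriv i (inChart x₀ ψ) y) := fun i ↦ by
      simp only [hW]; ring
    rw [hgr, mul_sub, Finset.mul_sum, Finset.sum_congr rfl fun i _ ↦ h1 i]
    ring
  · exact (hΦ.continuous_inner_gradient hf hψ).sub
      (hΦ.continuous_mul_coordinate_mul hψ.continuous)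
  · intro p hp
    have hpt : p ∉ tsupport ψ := fun h ↦ hp (hsupp h)
    rw [image_eq_zero_of_notMem_tsupport hpt, g.symm, inner_gradient,
      differential_eq_zero_of_notMem_tsupport hpt]
    simp

variable [CompactSpace M]

theorem integrable_of_continuous {F : M → ℝ} (hF : Continuous F) :
    Integrable F (riemannianVolume g) := by
  have := hΦ.isFiniteMeasure_riemannianVolume
  exact hF.integrable_of_hasCompactSupport
    (HasCompactSupport.of_compactSpace F)

theorem integrable_inner_gradient {u w : M → ℝ} (hu : ContMDiff (𝓡∂ k) 𝓘(ℝ, ℝ) ∞ u)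
    (hw : ContMDiff (𝓡∂ k) 𝓘(ℝ, ℝ) ∞ w) :
    Integrable (fun p ↦ g.inner p (gradient g u p) (gradient g w p)) (riemannianVolume g) :=
  hΦ.integrable_of_continuous (hΦ.continuous_inner_gradient hu hw)

/-- The weak form of `-Δ_g (Φ⁰ - a) = k Φ⁰`. -/
theorem integral_inner_gradient [T2Space M] (a : ℝ) {φ : M → ℝ}
    (hφ : ContMDiff (𝓡∂ k) 𝓘(ℝ, ℝ) ∞ φ) (hbd : ∀ p ∈ (𝓡∂ k).boundary M, φ p = 0) :
    ∫ p, (g.inner p (gradient g (fun q ↦ Φ q 0 - a) p) (gradient g φ p) - k * Φ p 0 * φ p)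
      ∂riemannianVolume g = 0 := by
  obtain ⟨t, ht⟩ := CompactSpace.elim_nhds_subcover
    (fun p : M ↦ (chartAt (EuclideanHalfSpace k) p).source)
    fun p ↦ (chartAt (EuclideanHalfSpace k) p).open_source.mem_nhds (mem_chart_source _ p)
  set x : Fin t.card → M := fun i ↦ t.equivFin.symm i with hx
  -- The integrand is linear in the test function, and each `ρᵢ φ` is supported in a chart and still
  -- vanishes on the boundary.
  obtain ⟨ρ, hρ⟩ := SmoothPartitionOfUnity.exists_isSubordinate (𝓡∂ k) (isClosed_univ (X := M))
    (fun i ↦ (chartAt (EuclideanHalfSpace k) (x i)).source)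
    (fun i ↦ (chartAt (EuclideanHalfSpace k) (x i)).open_source) (fun p _ ↦ by
      have hp : p ∈ ⋃ y ∈ t, (chartAt (EuclideanHalfSpace k) y).source := by
        rw [ht]; trivial
      obtain ⟨y, hy, hpy⟩ := mem_iUnion₂.1 hp
      exact mem_iUnion.2 ⟨t.equivFin ⟨y, hy⟩, by simpa [hx] using hpy⟩)
  have hf := hΦ.contMDiff_coordinate a
  have hψ : ∀ i, ContMDiff (𝓡∂ k) 𝓘(ℝ, ℝ) ∞ fun p ↦ ρ i p * φ p := fun i ↦
    (ρ i).contMDiff.mul hφ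
  have hsum : φ = ∑ i, fun p ↦ ρ i p * φ p := by
    ext p
    have h1 := ρ.sum_eq_one (mem_univ p)
    rw [finsum_eq_sum_of_fintype] at h1
    rw [Finset.sum_apply, ← Finset.sum_mul, h1, one_mul]
  have hdiff : ∀ p, differential φ p = ∑ i, differential (fun p ↦ ρ i p * φ p) p := fun p ↦ by
    conv_lhs => rw [hsum]
    exact (HasMFDerivAt.sum fun i _ ↦ ((hψ i).mdifferentiable (by simp) p).hasMFDerivAt).mfderiv
  have hpt : ∀ p, g.inner p (gradient g (fun q ↦ Φ q 0 - a) p) (gradient g φ p) -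
      k * Φ p 0 * φ p = ∑ i, (g.inner p (gradient g (fun q ↦ Φ q 0 - a) p)
        (gradient g (fun p ↦ ρ i p * φ p) p) - k * Φ p 0 * (ρ i p * φ p)) := fun p ↦ by
    have h1 := congrFun hsum p
    rw [Finset.sum_apply] at h1
    rw [Finset.sum_sub_distrib, ← Finset.mul_sum, ← h1, g.symm, inner_gradient, hdiff]
    congr 1
    rw [sum_apply]
    exact Finset.sum_congr rfl fun i _ ↦ by rw [g.symm, inner_gradient]
  simp only [hpt]
  refine (integral_finsetSum _ fun i _ ↦ (hΦ.integrable_inner_gradient hf (hψ i)).sub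
    (hΦ.integrable_of_continuous (hΦ.continuous_mul_coordinate_mul (hψ i).continuous))).trans ?_
  refine Finset.sum_eq_zero fun i _ ↦ ?_
  exact hΦ.integral_inner_gradient_of_tsupport_subset a (hψ i)
    (tsupport_mul_subset_left.trans (hρ i)) fun p hp ↦ by rw [hbd p hp, mul_zero]

/-- Barta's argument: the positive function `Φ⁰ - a` bounds the Dirichlet energy from below. -/
theorem mul_integral_sq_le [T2Space M] {a : ℝ} (ha : 0 < a) (ha' : a < Real.cos r) {u : M → ℝ}
    (hu : ContMDiff (𝓡∂ k) 𝓘(ℝ, ℝ) ∞ u) (hbd : ∀ p ∈ (𝓡∂ k).boundary M, u p = 0) :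
    k * (1 + a) * ∫ p, u p ^ 2 ∂riemannianVolume g ≤
      ∫ p, gradNormSq g u p ∂riemannianVolume g := by
  have hfpos : ∀ p, 0 < Φ p 0 - a := fun p ↦ by linarith [(hΦ.mem_cap p).2]
  have hf := hΦ.contMDiff_coordinate a
  set f : M → ℝ := fun p ↦ Φ p 0 - a with hfdef
  -- Barta's test function `u² / f`, smooth up to the boundary because `f > 0` there too.
  set φ : M → ℝ := fun p ↦ u p * u p / f p with hφdef
  have hφ : ContMDiff (𝓡∂ k) 𝓘(ℝ, ℝ) ∞ φ := (hu.mul hu).div₀ hf fun p ↦ (hfpos p).ne'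
  have hφb : ∀ p ∈ (𝓡∂ k).boundary M, φ p = 0 := fun p hp ↦ by simp [hφdef, hbd p hp]
  have h0 := hΦ.integral_inner_gradient a hφ hφb
  rw [integral_sub (hΦ.integrable_inner_gradient hf hφ)
    (hΦ.integrable_of_continuous
      (hΦ.continuous_mul_coordinate_mul hφ.continuous)), sub_eq_zero] at h0
  have hnonneg : ∀ (p : M) (v : TangentSpace (𝓡∂ k) p), 0 ≤ g.inner p v v := fun p v ↦ by
    by_cases hv : v = 0
    · simp [hv]
    · exact (g.pos p v hv).le
  -- Picone's identity: `⟨∇f, ∇(u²/f)⟩ = |∇u|² - |∇u - (u/f) ∇f|²`. It is proved after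
  -- multiplication by `f²`, with `dφ` obtained by differentiating `φ f = u²`.
  have h1 : ∀ p, g.inner p (gradient g f p) (gradient g φ p) ≤ gradNormSq g u p := fun p ↦ by
    have hd : f p • differential (k := k) φ p =
        (2 * u p) • differential u p - φ p • differential f p := by
      have hfd := (hf.mdifferentiable (by simp) p).hasMFDerivAt
      have hφd := (hφ.mdifferentiable (by simp) p).hasMFDerivAt
      have hud := (hu.mdifferentiable (by simp) p).hasMFDerivAt
      have heq : φ * f = u * u := by
        ext q
        simp only [Pi.mul_apply, hφdef]
        rw [div_mul_cancel₀ _ (hfpos q).ne']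
      have h2 := (hφd.mul hfd).mfderiv
      rw [heq, (hud.mul hud).mfderiv] at h2
      rw [eq_sub_iff_add_eq, two_mul, add_smul, add_comm]
      exact h2.symm
    set X := gradient g f p
    set Y := gradient g u p
    have hdX := DFunLike.congr_fun hd X
    simp only [smul_apply, sub_apply, smul_eq_mul, ← inner_gradient g] at hdX
    have hsq := hnonneg p (f p • Y - u p • X)
    simp only [map_sub, map_smul, smul_apply, sub_apply, smul_eq_mul] at hsq
    rw [g.symm p X Y] at hsq
    rw [gradNormSq, g.symm p X]
    have hφf : φ p * f p = u p * u p := by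
      simp only [hφdef]
      rw [div_mul_cancel₀ _ (hfpos p).ne']
    have hfp : 0 < f p * f p := mul_pos (hfpos p) (hfpos p)
    refine le_of_mul_le_mul_left ?_ hfp
    have h3 : f p * f p * g.inner p (gradient g φ p) X =
        2 * f p * u p * g.inner p Y X - u p * u p * g.inner p X X := by
      rw [mul_assoc, hdX, ← hφf]; ring
    rw [h3]
    linarith
  -- Here `u² = f φ` with `φ ≥ 0`, so the claim reduces to `(1 + a) f ≤ Φ⁰`.
  have h2 : ∀ p, k * (1 + a) * u p ^ 2 ≤ k * Φ p 0 * φ p := fun p ↦ by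
    have h3 : (1 + a) * f p ≤ Φ p 0 := by
      simp only [hfdef]
      nlinarith [hΦ.le_one p, hfpos p]
    have h4 : u p ^ 2 = f p * φ p := by
      simp only [hφdef]
      rw [mul_div_cancel₀ _ (hfpos p).ne', sq]
    have h5 : 0 ≤ φ p := div_nonneg (mul_self_nonneg _) (hfpos p).le
    have h6 : 0 ≤ k * φ p := mul_nonneg (Nat.cast_nonneg k) h5
    rw [h4]
    nlinarith [mul_le_mul_of_nonneg_left h3 h6]
  rw [← integral_const_mul]
  calc ∫ p, k * (1 + a) * u p ^ 2 ∂riemannianVolume g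
      ≤ ∫ p, k * Φ p 0 * φ p ∂riemannianVolume g :=
        integral_mono (hΦ.integrable_of_continuous (continuous_const.mul (hu.continuous.pow 2)))
          (hΦ.integrable_of_continuous (hΦ.continuous_mul_coordinate_mul hφ.continuous)) h2
    _ = ∫ p, g.inner p (gradient g f p) (gradient g φ p) ∂riemannianVolume g := h0.symm
    _ ≤ ∫ p, gradNormSq g u p ∂riemannianVolume g :=
        integral_mono (hΦ.integrable_inner_gradient hf hφ)
          (hΦ.integrable_inner_gradient hu hu) h1

end IsFreeBoundaryMinimalImmersion

end WeakFormulation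

end SphericalCap

end

/-! ### Choice of the constant and conclusion -/

theorem mainTheorem9 {k n : ℕ} [NeZero k] {r : ℝ} (hr : 0 < r) (hr' : r < Real.pi / 2)
    {M : Type*} [TopologicalSpace M] [T2Space M] [CompactSpace M]
    [ChartedSpace (EuclideanHalfSpace k) M] [IsManifold (𝓡∂ k) ∞ M]
    [MeasurableSpace M] [BorelSpace M]
    (g : SphericalCap.Metric k M) (Φ : M → SphericalCap.Ambient n)
    (hΦ : SphericalCap.IsFreeBoundaryMinimalImmersion g r Φ) :
    -- the Dirichlet problem has no nontrivial solution for any `lam ≤ 0`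
    (∀ lam : ℝ, lam ≤ 0 → ∀ w : M → ℝ, SphericalCap.SolvesDirichlet g k lam w → w = 0) ∧
    -- the first Dirichlet eigenvalue is greater than `k`
    ((k : ℝ) : EReal) < SphericalCap.firstDirichletEigenvalue g ∧
    -- the same in variational form: the infimum of the Rayleigh quotients is greater than `k`
    (∃ c : ℝ, (k : ℝ) < c ∧ ∀ u : M → ℝ, ContMDiff (𝓡∂ k) 𝓘(ℝ, ℝ) ∞ u →
      (∀ p ∈ (𝓡∂ k).boundary M, u p = 0) →
        c * ∫ p, u p ^ 2 ∂(SphericalCap.riemannianVolume g) ≤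
          ∫ p, SphericalCap.gradNormSq g u p ∂(SphericalCap.riemannianVolume g)) ∧
    -- the integral inequality
    (∀ u : M → ℝ, ContMDiff (𝓡∂ k) 𝓘(ℝ, ℝ) ∞ u → (∀ p ∈ (𝓡∂ k).boundary M, u p = 0) →
      Integrable (fun p ↦ SphericalCap.gradNormSq g u p) (SphericalCap.riemannianVolume g) ∧
      Integrable (fun p ↦ u p ^ 2) (SphericalCap.riemannianVolume g) ∧
      0 ≤ ∫ p, (SphericalCap.gradNormSq g u p - k * u p ^ 2)
        ∂(SphericalCap.riemannianVolume g)) := by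
  have hcos : 0 < Real.cos r := Real.cos_pos_of_mem_Ioo ⟨by linarith, hr'⟩
  -- Any `a` strictly between `0` and `cos r` would do; the midpoint gives the gap constant `k (1 +
  -- cos r / 2)`.
  have ha : 0 < Real.cos r / 2 := half_pos hcos
  have ha' : Real.cos r / 2 < Real.cos r := half_lt_self hcos
  have hk : (0 : ℝ) < k := Nat.cast_pos.2 (Nat.pos_of_ne_zero (NeZero.ne k))
  have hc : (k : ℝ) < k * (1 + Real.cos r / 2) := by nlinarith
  refine ⟨fun lam hlam w hw ↦ ?_, ?_, ⟨_, hc, fun u hu hbd ↦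
    hΦ.mul_integral_sq_le ha ha' hu hbd⟩, fun u hu hbd ↦ ?_⟩
  · by_contra hne
    have := hΦ.le_of_solvesDirichlet ha ha' hw hne
    linarith
  -- Strictness survives the infimum since all eigenvalues obey the same bound `k (1 + cos r / 2)`.
  · refine (EReal.coe_lt_coe_iff.2 hc).trans_le (le_sInf ?_)
    rintro _ ⟨lam, ⟨w, hne, hw⟩, rfl⟩
    have := hΦ.le_of_solvesDirichlet ha ha' hw hne
    rw [zero_add] at this
    exact EReal.coe_le_coe_iff.2 this
  -- Integrability is needed to split the integral, and a Bochner integral of a non-integrable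
  -- function would be `0` by convention.
  · have h1 : Integrable (fun p ↦ SphericalCap.gradNormSq g u p)
        (SphericalCap.riemannianVolume g) := hΦ.integrable_inner_gradient hu hu
    have h2 : Integrable (fun p ↦ u p ^ 2) (SphericalCap.riemannianVolume g) :=
      hΦ.integrable_of_continuous (hu.continuous.pow 2)
    refine ⟨h1, h2, ?_⟩
    rw [integral_sub h1 (h2.const_mul _), integral_const_mul, sub_nonneg]
    refine le_trans ?_ (hΦ.mul_integral_sq_le ha ha' hu hbd)
    exact mul_le_mul_of_nonneg_right hc.le (integral_nonneg fun p ↦ sq_nonneg _)
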